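/- Let $l>0$, $I=(-\tfrac l2,\tfrac l2)$, $S=I\times(-\tfrac12,\tfrac12)$, $\Gamma=\partial I\times(-\tfrac12,\tfrac12)$. For $X\in\{W,R\}$ let $Q_X^2$ be a quadratic form on $\mathbb R^{2\times2}$ that depends only on the symmetric part of its argument and is positive definite on symmetric matrices; write $Q_X^2(q_{11},q_{12},q_{22})$ for its value at the symmetric matrix with these entries, and set $$Q_X^1(q_{11},q_{12})=\min_{\alpha\in\mathbb R}Q_X^2(q_{11},q_{12},\alpha),\qquad Q_X^0(q_{11})=\min_{z\in\mathbb R}Q_X^1(q_{11},z).$$ For $\hat u_1\in W^{1,2}(I)$ and $\hat u_2,\hat v\in W^{2,2}(I)$ let $BN_{(\hat u_1,\hat u_2)}(S;\mathbb R^2)$ be the set of $y\in W^{1,2}(S;\mathbb R^2)$ with $e(y)_{12}=e(y)_{22}=0$, where $e(y)=\frac12(\nabla y+\nabla y^T)$, and with $y_1=\hat u_1-x_2\hat u_2'$, $y_2=\hat u_2$ on $\Gamma$ in the sense of traces. Let $W^{2,2}_{\hat v}(I)$ be the set of $w\in W^{2,2}(I)$ with $w=\hat v$, $w'=\hat v'$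 on $\partial I$, and put $$\mathscr S^{1D}=BN_{(\hat u_1,\hat u_2)}(S;\mathbb R^2)\times W^{2,2}_{\hat v}(I)\times W^{1,2}_0(I),$$ with $\|(y,w,\theta)\|_{can}=\|y\|_{W^{1,2}(S;\mathbb R^2)}+\|w\|_{W^{2,2}(I)}+\|\theta\|_{W^{1,2}(I)}$. Functions on $I$ are regarded as functions on $S$ that do not depend on $x_2$. For $u=(y,w,\theta)$ and $\tilde u=(\tilde y,\tilde w,\tilde\theta)$ in $\mathscr S^{1D}$ define the (force-free) energy and the dissipation distance $$\phi_0(u)=\frac12\int_S Q_W^0\Big(\partial_1y_1+\frac{|w'|^2}2\Big)+\frac1{24}\int_I Q_W^1(w'',\theta'),$$ $$\mathcal D_0(u,\tilde u)=\Big(\int_S Q_R^0\Big(\partial_1y_1-\partial_1\tilde y_1+\frac{|w'|^2}2-\frac{|\tilde w'|^2}2\Big)+\frac1{12}\int_I Q_R^1(w''-\tilde w'',\theta'-\tilde\theta')\Big)^{1/2}.$$ For $C,M>0$ let $\Phi^1(t)=\sqrt{t^2+Ct^3+Ct^4}$ and $\Phi^2_M(t)=C\sqrt M\,t^2+Ct^3+Ct^4$.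 Write $h^+=\max(h,0)$. The local slope is $$|\partial\phi_0|_{\mathcal D_0}(u)=\limsup_{\mathcal D_0(u,\tilde u)\to0,\ \tilde u\ne u}\frac{(\phi_0(u)-\phi_0(\tilde u))^+}{\mathcal D_0(u,\tilde u)}\in[0,\infty].$$ There is a constant $C_0>0$ depending only on $l$, $Q_W^2$, $Q_R^2$ such that, for all $\hat u_1\in W^{1,2}(I)$ and $\hat u_2,\hat v\in W^{2,2}(I)$, the following holds. (i) For all $C\ge C_0$, all $M>0$ and all $u\in\mathscr S^{1D}$ with $\phi_0(u)\le M$, $$|\partial\phi_0|_{\mathcal D_0}(u)=\sup_{\tilde u\in\mathscr S^{1D},\ \tilde u\neq u}\frac{\big(\phi_0(u)-\phi_0(\tilde u)-\Phi^2_M(\mathcal D_0(u,\tilde u))\big)^+}{\Phi^1(\mathcal D_0(u,\tilde u))}.$$ (ii) $|\partial\phi_0|_{\mathcal D_0}$ is a strong upper gradient for $\phi_0$: for every open interval $J\subset\mathbb R$ and every curve $z\colon J\to\mathscr S^{1D}$ that is absolutely continuous with respect to $\mathcal D_0$ (that is, for some $m\in L^1(J)$, $\mathcal D_0(z(s),z(t))\le\int_s^t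 m(r)\,dr$ for all $s\le t$ in $J$), the function $|\partial\phi_0|_{\mathcal D_0}\circ z$ is Borel and $$|\phi_0(z(t))-\phi_0(z(s))|\le\int_s^t|\partial\phi_0|_{\mathcal D_0}(z(r))\,|z'|_{\mathcal D_0}(r)\,dr\qquad\text{for all }s\le t\text{ in }J,$$ where $|z'|_{\mathcal D_0}(r)=\lim_{s\to r}\mathcal D_0(z(s),z(r))/|s-r|$ (which exists for a.e. $r$) is the metric derivative. (iii) If a sequence $(u_k)_k\subset\mathscr S^{1D}$ converges weakly with respect to $\|\cdot\|_{can}$ to $u\in\mathscr S^{1D}$, then $\liminf_{k\to\infty}|\partial\phi_0|_{\mathcal D_0}(u_k)\ge|\partial\phi_0|_{\mathcal D_0}(u)$. -/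

import Mathlib

open MeasureTheory Filter Topology Set
open scoped ContDiff ENNReal

noncomputable section

namespace VKRibbon

/-! ### Weak derivatives, traces and Sobolev spaces -/

/-- `v` is the weak derivative of `u` on the open set `Ω` in the direction `e`:
`∫_Ω u ∂ₑφ = - ∫_Ω v φ` for every `φ ∈ C_c^∞(Ω)`. -/
def HasWeakDeriv {V : Type*} [NormedAddCommGroup V] [NormedSpace ℝ V] [MeasureSpace V]
    (Ω : Set V) (e : V) (u v : V → ℝ) : Prop :=
  ∀ φ : V → ℝ, ContDiff ℝ ∞ φ → HasCompactSupport φ → tsupport φ ⊆ Ω →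
    ∫ x in Ω, u x * fderiv ℝ φ x e = -∫ x in Ω, v x * φ x

/-- Vanishing trace, expressed through Green's formula.  If `u` is a Sobolev function on the
Lipschitz domain `Ω` and `v = ∂ₑ u`, then `∫_Ω (u ∂ₑφ + v φ) = ∫_{∂Ω} (tr u) φ (e · ν)` for all
`φ ∈ C_c^∞(V)`, `ν` the outer unit normal; the predicate says that this vanishes for all `φ`,
i.e. that `tr u = 0` almost everywhere on the part of `∂Ω` where `e · ν ≠ 0`.
For `Ω` an interval and `e = 1` this part consists of the two end points; for a rectangle
with sides parallel to the axes and `e = (1, 0)` it consists of the two vertical sides. -/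
def HasZeroTrace {V : Type*} [NormedAddCommGroup V] [NormedSpace ℝ V] [MeasureSpace V]
    (Ω : Set V) (e : V) (u v : V → ℝ) : Prop :=
  ∀ φ : V → ℝ, ContDiff ℝ ∞ φ → HasCompactSupport φ →
    ∫ x in Ω, (u x * fderiv ℝ φ x e + v x * φ x) = 0

section Linear

variable {V : Type*} [NormedAddCommGroup V] [NormedSpace ℝ V] [MeasureSpace V] [BorelSpace V]
  [IsFiniteMeasureOnCompacts (volume : Measure V)] {Ω : Set V} {e : V}

theorem integrable_mul_test (u : Lp ℝ 2 (volume.restrict Ω)) {φ : V → ℝ} (hφ : Continuous φ)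
    (hc : HasCompactSupport φ) : Integrable (fun x => u x * φ x) (volume.restrict Ω) :=
  (Lp.memLp u).integrable_mul (q := 2) ((hφ.memLp_of_hasCompactSupport hc).restrict Ω)

theorem continuous_dirDeriv {φ : V → ℝ} (hφ : ContDiff ℝ ∞ φ) :
    Continuous (fun x => fderiv ℝ φ x e) :=
  (hφ.continuous_fderiv (by simp)).clm_apply continuous_const

theorem hasCompactSupport_dirDeriv {φ : V → ℝ} (hc : HasCompactSupport φ) :
    HasCompactSupport (fun x => fderiv ℝ φ x e) :=
  hc.fderiv_apply (𝕜 := ℝ) e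

theorem integral_add_mul (u u' : Lp ℝ 2 (volume.restrict Ω)) {φ : V → ℝ} (hφ : Continuous φ)
    (hc : HasCompactSupport φ) :
    ∫ x in Ω, (u + u' : Lp ℝ 2 (volume.restrict Ω)) x * φ x
      = (∫ x in Ω, u x * φ x) + ∫ x in Ω, u' x * φ x := by
  rw [← integral_add (integrable_mul_test u hφ hc) (integrable_mul_test u' hφ hc)]
  refine integral_congr_ae ?_
  filter_upwards [Lp.coeFn_add u u'] with x hx
  rw [hx, Pi.add_apply, add_mul]

theorem integral_smul_mul (c : ℝ) (u : Lp ℝ 2 (volume.restrict Ω)) (φ : V → ℝ) :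
    ∫ x in Ω, (c • u : Lp ℝ 2 (volume.restrict Ω)) x * φ x = c * ∫ x in Ω, u x * φ x := by
  rw [← integral_const_mul]
  refine integral_congr_ae ?_
  filter_upwards [Lp.coeFn_smul c u] with x hx
  rw [hx, Pi.smul_apply, smul_eq_mul, mul_assoc]

theorem HasWeakDeriv.add {u v u' v' : Lp ℝ 2 (volume.restrict Ω)} (h : HasWeakDeriv Ω e u v)
    (h' : HasWeakDeriv Ω e u' v') :
    HasWeakDeriv Ω e (u + u' : Lp ℝ 2 (volume.restrict Ω))
      (v + v' : Lp ℝ 2 (volume.restrict Ω)) := by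
  intro φ hφ hc hs
  rw [integral_add_mul u u' (continuous_dirDeriv hφ) (hasCompactSupport_dirDeriv hc),
    integral_add_mul v v' hφ.continuous hc, h φ hφ hc hs, h' φ hφ hc hs]
  ring

theorem HasWeakDeriv.smul {u v : Lp ℝ 2 (volume.restrict Ω)} (c : ℝ)
    (h : HasWeakDeriv Ω e u v) :
    HasWeakDeriv Ω e (c • u : Lp ℝ 2 (volume.restrict Ω))
      (c • v : Lp ℝ 2 (volume.restrict Ω)) := by
  intro φ hφ hc hs
  rw [integral_smul_mul, integral_smul_mul, h φ hφ hc hs]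
  ring

theorem HasWeakDeriv.zero :
    HasWeakDeriv Ω e (0 : Lp ℝ 2 (volume.restrict Ω)) (0 : Lp ℝ 2 (volume.restrict Ω)) := by
  intro φ hφ hc hs
  have h0 : ∀ ψ : V → ℝ, ∫ x in Ω, (0 : Lp ℝ 2 (volume.restrict Ω)) x * ψ x = 0 := by
    intro ψ
    rw [← zero_smul ℝ (0 : Lp ℝ 2 (volume.restrict Ω)), integral_smul_mul, zero_mul]
  rw [h0, h0, neg_zero]

end Linear

/-- The interval `I = (-l/2, l/2)`. -/
def I (l : ℝ) : Set ℝ := Ioo (-(l / 2)) (l / 2)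

/-- The rectangle `S = I × (-1/2, 1/2)`. -/
def S (l : ℝ) : Set (ℝ × ℝ) := I l ×ˢ Ioo (-(1 / 2)) (1 / 2)

/-- `L²(I)`. -/
abbrev L2I (l : ℝ) := Lp ℝ 2 (volume.restrict (I l))

/-- `L²(S)`. -/
abbrev L2S (l : ℝ) := Lp ℝ 2 (volume.restrict (S l))

/-- `W^{k,2}(I)`: a function together with its weak derivatives (`u j` is the derivative of
order `j`), all in `L²(I)`, with the norm `(∑_{j ≤ k} ‖u j‖²_{L²})^{1/2}`. -/
def SobolevI (l : ℝ) (k : ℕ) : Submodule ℝ (PiLp 2 (fun _ : Fin (k + 1) => L2I l)) where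
  carrier := {u | ∀ j : Fin k, HasWeakDeriv (I l) 1 (u j.castSucc) (u j.succ)}
  add_mem' hu hv j := (hu j).add (hv j)
  zero_mem' _ := HasWeakDeriv.zero
  smul_mem' c _ hu j := (hu j).smul c

/-- `W^{1,2}(S; ℝ²)`: for the component `i`, the entry `(i, 0)` is `yᵢ`, and the entries
`(i, 1)`, `(i, 2)` are its weak partial derivatives `∂₁ yᵢ`, `∂₂ yᵢ`; the norm is the square root
of the sum of the squared `L²` norms of all entries. -/
def SobolevS (l : ℝ) : Submodule ℝ (PiLp 2 (fun _ : Fin 2 × Fin 3 => L2S l)) where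
  carrier := {y | ∀ i : Fin 2, HasWeakDeriv (S l) (1, 0) (y (i, 0)) (y (i, 1)) ∧
    HasWeakDeriv (S l) (0, 1) (y (i, 0)) (y (i, 2))}
  add_mem' hu hv i := ⟨(hu i).1.add (hv i).1, (hu i).2.add (hv i).2⟩
  zero_mem' _ := ⟨HasWeakDeriv.zero, HasWeakDeriv.zero⟩
  smul_mem' c _ hu i := ⟨(hu i).1.smul c, (hu i).2.smul c⟩

/-- `u ∈ W^{k,2}_{uhat}(I)`: the traces of `u` and `uhat` at the end points of `I` agree up to the
order `k - 1`. -/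
def HasBoundaryValues {l : ℝ} {k : ℕ} (u uhat : SobolevI l k) : Prop :=
  ∀ j : Fin k, HasZeroTrace (I l) 1
    (fun x => u.1 j.castSucc x - uhat.1 j.castSucc x) (fun x => u.1 j.succ x - uhat.1 j.succ x)

/-- The Bernoulli-Navier functions with boundary data `(uhat₁, uhat₂)`: `y ∈ W^{1,2}(S; ℝ²)` with
`e(y)₁₂ = e(y)₂₂ = 0` and, in the sense of traces, `y₁ = uhat₁ - x₂ uhat₂'` and `y₂ = uhat₂` on
`Γ = ∂I × (-1/2, 1/2)`. -/
def IsBernoulliNavier {l : ℝ} (uhat₁ : SobolevI l 1) (uhat₂ : SobolevI l 2) (y : SobolevS l) : Prop :=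
  (∀ᵐ x ∂volume.restrict (S l), (y.1 (0, 2) x + y.1 (1, 1) x) / 2 = 0) ∧
  (∀ᵐ x ∂volume.restrict (S l), y.1 (1, 2) x = 0) ∧
  HasZeroTrace (S l) (1, 0)
    (fun x => y.1 (0, 0) x - (uhat₁.1 0 x.1 - x.2 * uhat₂.1 1 x.1))
    (fun x => y.1 (0, 1) x - (uhat₁.1 1 x.1 - x.2 * uhat₂.1 2 x.1)) ∧
  HasZeroTrace (S l) (1, 0)
    (fun x => y.1 (1, 0) x - uhat₂.1 0 x.1)
    (fun x => y.1 (1, 1) x - uhat₂.1 1 x.1)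

/-- `W^{1,2}(S; ℝ²) × W^{2,2}(I) × W^{1,2}(I)` with the canonical norm
`‖y‖ + ‖w‖ + ‖θ‖`. -/
abbrev Ambient (l : ℝ) :=
  WithLp 1 (SobolevS l × WithLp 1 (SobolevI l 2 × SobolevI l 1))

namespace Ambient

variable {l : ℝ}

/-- The in-plane displacement `y`. -/
abbrev y (u : Ambient l) : SobolevS l := u.fst

/-- The out-of-plane displacement `w`. -/
abbrev w (u : Ambient l) : SobolevI l 2 := u.snd.fst

/-- The twist `θ`. -/
abbrev θ (u : Ambient l) : SobolevI l 1 := u.snd.snd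

end Ambient

/-- The admissible states `BN_{(uhat₁, uhat₂)}(S; ℝ²) × W^{2,2}_{vhat}(I) × W^{1,2}_0(I)`. -/
def S1D {l : ℝ} (uhat₁ : SobolevI l 1) (uhat₂ vhat : SobolevI l 2) : Set (Ambient l) :=
  {u | IsBernoulliNavier uhat₁ uhat₂ u.y ∧ HasBoundaryValues u.w vhat ∧ HasBoundaryValues u.θ 0}

/-! ### Quadratic forms, energy and dissipation distance -/

/-- A quadratic form on `ℝ^{2×2}` that depends only on the symmetric part of its argument and is
positive definite on symmetric matrices. -/
structure IsAdmissibleForm (Q : QuadraticForm ℝ (Matrix (Fin 2) (Fin 2) ℝ)) : Prop where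
  symmPart : ∀ A, Q A = Q ((1 / 2 : ℝ) • (A + A.transpose))
  pos : ∀ A : Matrix (Fin 2) (Fin 2) ℝ, A.IsSymm → A ≠ 0 → 0 < Q A

/-- `Q¹(q₁₁, q₁₂) = min_α Q²(q₁₁, q₁₂, α)`. -/
def Q1 (Q : QuadraticForm ℝ (Matrix (Fin 2) (Fin 2) ℝ)) (q₁₁ q₁₂ : ℝ) : ℝ :=
  ⨅ α : ℝ, Q !![q₁₁, q₁₂; q₁₂, α]

/-- `Q⁰(q₁₁) = min_z Q¹(q₁₁, z)`. -/
def Q0 (Q : QuadraticForm ℝ (Matrix (Fin 2) (Fin 2) ℝ)) (q₁₁ : ℝ) : ℝ :=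
  ⨅ z : ℝ, Q1 Q q₁₁ z

/-- The (force-free) energy
`φ₀(y, w, θ) = ½ ∫_S Q_W⁰(∂₁y₁ + |w'|²/2) + (1/24) ∫_I Q_W¹(w'', θ')`. -/
def energy {l : ℝ} (QW : QuadraticForm ℝ (Matrix (Fin 2) (Fin 2) ℝ)) (u : Ambient l) : ℝ :=
  1 / 2 * (∫ x in S l, Q0 QW (u.y.1 (0, 1) x + (u.w.1 1 x.1) ^ 2 / 2))
    + 1 / 24 * (∫ t in I l, Q1 QW (u.w.1 2 t) (u.θ.1 1 t))

/-- The dissipation distance `𝒟₀`, the square root of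
`∫_S Q_R⁰(∂₁y₁ - ∂₁ỹ₁ + |w'|²/2 - |w̃'|²/2) + (1/12) ∫_I Q_R¹(w'' - w̃'', θ' - θ̃')`. -/
def dissip {l : ℝ} (QR : QuadraticForm ℝ (Matrix (Fin 2) (Fin 2) ℝ)) (u v : Ambient l) : ℝ :=
  √((∫ x in S l, Q0 QR (u.y.1 (0, 1) x - v.y.1 (0, 1) x
        + (u.w.1 1 x.1) ^ 2 / 2 - (v.w.1 1 x.1) ^ 2 / 2))
    + 1 / 12 * (∫ t in I l, Q1 QR (u.w.1 2 t - v.w.1 2 t) (u.θ.1 1 t - v.θ.1 1 t)))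

/-! ### Slopes and upper gradients -/

section Metric

variable {X : Type*} (D : X → X → ℝ)

/-- The local slope `limsup_{z → u} (φ(u) - φ(z))⁺ / D(u, z)`, the limit being taken over
`z ≠ u` with `D(u, z) → 0`. -/
def localSlope (φ : X → ℝ) (u : X) : ℝ≥0∞ :=
  limsup (fun z => ENNReal.ofReal (max (φ u - φ z) 0 / D u z))
    (comap (D u) (𝓝 0) ⊓ 𝓟 {u}ᶜ)

/-- Absolutely continuous curves on an open interval `J` (only the values on `J` matter). -/
def IsACCurve (J : Set ℝ) (γ : ℝ → X) : Prop :=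
  ∃ m : ℝ → ℝ, IntegrableOn m J ∧
    ∀ s ∈ J, ∀ t ∈ J, s ≤ t → D (γ s) (γ t) ≤ ∫ r in s..t, m r

/-- The metric derivative `|γ'|(t) = lim_{s → t} D(γ(s), γ(t)) / |s - t|`; for an absolutely
continuous curve the limit exists at almost every `t`, and where it exists it is the `limsup`. -/
def metricDeriv (γ : ℝ → X) (t : ℝ) : ℝ≥0∞ :=
  limsup (fun s => ENNReal.ofReal (D (γ s) (γ t) / |s - t|)) (𝓝[≠] t)

/-- `g` is a strong upper gradient for `φ`: for every absolutely continuous curve `γ` on an open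
(bounded or unbounded) interval `J`, `g ∘ γ` is Borel and
`|φ(γ(t)) - φ(γ(s))| ≤ ∫_s^t g(γ(r)) |γ'|(r) dr` for all `s ≤ t` in `J`. -/
def IsStrongUpperGradient (φ : X → ℝ) (g : X → ℝ≥0∞) : Prop :=
  ∀ (J : Set ℝ) (γ : ℝ → X), IsOpen J → J.OrdConnected → IsACCurve D J γ →
    Measurable (fun t : J => g (γ t)) ∧
    ∀ s ∈ J, ∀ t ∈ J, s ≤ t →
      ENNReal.ofReal |φ (γ t) - φ (γ s)| ≤ ∫⁻ r in Ioo s t, g (γ r) * metricDeriv D γ r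

end Metric

/-- `Φ¹(t) = √(t² + C t³ + C t⁴)`. -/
def Φ₁ (C t : ℝ) : ℝ := √(t ^ 2 + C * t ^ 3 + C * t ^ 4)

/-- `Φ²_M(t) = C √M t² + C t³ + C t⁴`. -/
def Φ₂ (C M t : ℝ) : ℝ := C * √M * t ^ 2 + C * t ^ 3 + C * t ^ 4

/-- The local slope `|∂φ₀|_{𝒟₀}` in the space `S1D` with distance `𝒟₀`. -/
def slope1D {l : ℝ} (QW QR : QuadraticForm ℝ (Matrix (Fin 2) (Fin 2) ℝ))
    (uhat₁ : SobolevI l 1) (uhat₂ vhat : SobolevI l 2) : S1D uhat₁ uhat₂ vhat → ℝ≥0∞ :=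
  localSlope (fun u v : S1D uhat₁ uhat₂ vhat => dissip QR u.1 v.1) (fun u => energy QW u.1)

end VKRibbon

end

open VKRibbon

/-!
Completing squares, the reduced forms become sums of squares, so the energy is `½‖A σ(u)‖²` and
the dissipation distance is `‖B σ(u) - B σ(v)‖` in a Hilbert space, where
`σ(u) = (∂₁y₁ + |w'|²/2, w'', θ')` is the strain, `A` and `B` are linear, and `B` is bounded below.

Along the segment from `u` to `v` the strain is affine up to `-s (1 - s) |v' - u'|² / 2`, where
`v' - u'` stands for the difference of the slopes `w'`.  This difference has zero trace, so the
defect is bounded by the squared distance of the end points.  Hence the energy is almost convex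
along segments, and the local slope is a supremum of difference quotients with explicit
corrections.  As the translates `z i + (v - u)` recover `v` along any `z i → u`, strongly in the
slopes, this supremum is lower semicontinuous along strong and weak convergence; the latter makes
the slopes `w'` converge strongly, again because their differences have zero trace.
Lower semicontinuity along `𝒟₀` and the local Lipschitz bound for the energy make the slope a
strong upper gradient.
-/

noncomputable section

namespace VKRibbon

/-! ### Local slopes as suprema -/

theorem ofReal_max_div_le {P d : ℝ} (hP : 0 < P) (hd : 0 < d) (N r : ℝ) :
    ENNReal.ofReal (max N 0 / d) ≤
      ENNReal.ofReal (max (N - r) 0 / P) * ENNReal.ofReal (P / d) + ENNReal.ofReal (r / d) := by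
  have hmax : max N 0 ≤ max (N - r) 0 + max r 0 := by
    simpa using max_add_add_le_max_add_max (a := N - r) (b := r) (c := 0) (d := 0)
  calc ENNReal.ofReal (max N 0 / d)
      ≤ ENNReal.ofReal (max (N - r) 0 / P * (P / d) + max r 0 / d) := by
        rw [div_mul_div_cancel₀ hP.ne', ← add_div]
        gcongr
    _ ≤ ENNReal.ofReal (max (N - r) 0 / P * (P / d)) + ENNReal.ofReal (max r 0 / d) :=
        ENNReal.ofReal_add_le
    _ = _ := by
        have hr : max r 0 / d = max (r / d) 0 := by rw [← max_div_div_right hd.le, zero_div]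
        rw [ENNReal.ofReal_mul (by positivity), hr, ENNReal.ofReal_max, ENNReal.ofReal_zero,
          max_eq_left (zero_le (a := ENNReal.ofReal (r / d)))]

section LocalSlope

variable {X : Type*} {D : X → X → ℝ} {φ : X → ℝ} {u : X}

theorem localSlope_le_iSup {Φ Ψ : ℝ → ℝ} (hΦ : Tendsto (fun t => Φ t / t) (𝓝[>] 0) (𝓝 1))
    (hΨ : Tendsto (fun t => Ψ t / t) (𝓝[>] 0) (𝓝 0)) :
    localSlope D φ u ≤
      ⨆ (v : X) (_ : u ≠ v), ENNReal.ofReal (max (φ u - φ v - Ψ (D u v)) 0 / Φ (D u v)) := by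
  set G := ⨆ (v : X) (_ : u ≠ v), ENNReal.ofReal (max (φ u - φ v - Ψ (D u v)) 0 / Φ (D u v))
  rcases eq_or_ne G ⊤ with hGtop | hGtop
  · exact hGtop ▸ le_top
  have hlim : Tendsto (fun t => G * ENNReal.ofReal (Φ t / t) + ENNReal.ofReal (Ψ t / t))
      (𝓝[>] 0) (𝓝 G) := by
    simpa using (ENNReal.Tendsto.const_mul (ENNReal.tendsto_ofReal hΦ) (Or.inr hGtop)).add
      (ENNReal.tendsto_ofReal hΨ)
  refine le_of_forall_gt_imp_ge_of_dense fun c hc => limsup_le_of_le (by isBoundedDefault) ?_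
  have hsmall := eventually_nhdsWithin_iff.1
    ((hΦ.eventually_const_lt one_pos).and (hlim.eventually_le_const hc))
  filter_upwards [mem_inf_of_left (preimage_mem_comap hsmall),
    mem_inf_of_right (mem_principal_self _)] with z hz hzu
  rcases le_or_gt (D u z) 0 with hD | hD
  · rw [ENNReal.ofReal_of_nonpos (div_nonpos_of_nonneg_of_nonpos (le_max_right _ _) hD)]
    exact zero_le
  obtain ⟨hΦpos, hle⟩ := hz hD
  have hΦ0 : 0 < Φ (D u z) := by simpa [hD] using div_pos_iff_of_pos_right hD |>.1 hΦpos
  calc ENNReal.ofReal (max (φ u - φ z) 0 / D u z)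
      ≤ ENNReal.ofReal (max (φ u - φ z - Ψ (D u z)) 0 / Φ (D u z))
          * ENNReal.ofReal (Φ (D u z) / D u z) + ENNReal.ofReal (Ψ (D u z) / D u z) :=
        ofReal_max_div_le hΦ0 hD _ _
    _ ≤ G * ENNReal.ofReal (Φ (D u z) / D u z) + ENNReal.ofReal (Ψ (D u z) / D u z) := by
        gcongr
        exact le_iSup₂ (f := fun (v : X) (_ : u ≠ v) =>
          ENNReal.ofReal (max (φ u - φ v - Ψ (D u v)) 0 / Φ (D u v))) z (Ne.symm hzu)
    _ ≤ c := hle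

theorem ofReal_div_le_localSlope (hD : ∀ v, 0 ≤ D u v) (hφ : ∀ v, D u v = 0 → φ v = φ u) {N P : ℝ}
    (hdescent : ∀ s ∈ Ioo (0 : ℝ) 1, ∃ z, s * N ≤ φ u - φ z ∧ D u z ≤ s * P) :
    ENNReal.ofReal (max N 0 / P) ≤ localSlope D φ u := by
  rcases le_or_gt N 0 with hN | hN
  · simp [max_eq_right hN]
  have : Nonempty X := ⟨u⟩
  choose! z hφz hDz using hdescent
  have hs : ∀ᶠ s in 𝓝[>] (0 : ℝ), s ∈ Ioo (0 : ℝ) 1 := Ioo_mem_nhdsGT one_pos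
  have hdecr : ∀ s ∈ Ioo (0 : ℝ) 1, 0 < φ u - φ (z s) := fun s hs =>
    (mul_pos hs.1 hN).trans_le (hφz s hs)
  have hz : Tendsto z (𝓝[>] 0) (comap (D u) (𝓝 0) ⊓ 𝓟 {u}ᶜ) := by
    refine tendsto_inf.2 ⟨tendsto_comap_iff.2 ?_, tendsto_principal.2 ?_⟩
    · have hP : Tendsto (fun s : ℝ => s * P) (𝓝[>] 0) (𝓝 0) := by
        simpa using ((continuous_mul_const P).tendsto 0).mono_left nhdsWithin_le_nhds
      exact squeeze_zero' (Eventually.of_forall fun s => hD _) (hs.mono hDz) hP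
    · filter_upwards [hs] with s hs hzu
      exact (hdecr s hs).ne' (by rw [hzu, sub_self])
  refine le_limsup_of_frequently_le (hz.frequently (Eventually.frequently ?_))
  filter_upwards [hs] with s hs
  have hDpos : 0 < D u (z s) := (hD _).lt_of_ne' fun h0 =>
    (hdecr s hs).ne' (by rw [hφ _ h0, sub_self])
  have hP : 0 < P := pos_of_mul_pos_right (hDpos.trans_le (hDz s hs)) hs.1.le
  apply ENNReal.ofReal_le_ofReal
  rw [max_eq_left hN.le, max_eq_left (hdecr s hs).le, div_le_div_iff₀ hP hDpos]
  calc N * D u (z s) ≤ N * (s * P) := by gcongr; exact hDz s hs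
    _ = s * N * P := by ring
    _ ≤ (φ u - φ (z s)) * P := by gcongr; exact hφz s hs

end LocalSlope

theorem tendsto_Φ₁_div (C : ℝ) : Tendsto (fun t => Φ₁ C t / t) (𝓝[>] 0) (𝓝 1) := by
  have hcont : Continuous fun t : ℝ => √(1 + C * t + C * t ^ 2) := by fun_prop
  have hlim : Tendsto (fun t : ℝ => √(1 + C * t + C * t ^ 2)) (𝓝[>] 0) (𝓝 1) := by
    simpa using (hcont.tendsto 0).mono_left nhdsWithin_le_nhds
  refine hlim.congr' ?_
  filter_upwards [self_mem_nhdsWithin] with t (ht : 0 < t)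
  have hsq : t ^ 2 + C * t ^ 3 + C * t ^ 4 = t ^ 2 * (1 + C * t + C * t ^ 2) := by ring
  rw [Φ₁, hsq, Real.sqrt_mul (sq_nonneg t), Real.sqrt_sq ht.le, mul_div_cancel_left₀ _ ht.ne']

theorem tendsto_Φ₂_div (C M : ℝ) : Tendsto (fun t => Φ₂ C M t / t) (𝓝[>] 0) (𝓝 0) := by
  have hcont : Continuous fun t : ℝ => C * √M * t + C * t ^ 2 + C * t ^ 3 := by fun_prop
  have hlim : Tendsto (fun t : ℝ => C * √M * t + C * t ^ 2 + C * t ^ 3) (𝓝[>] 0) (𝓝 0) := by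
    simpa using (hcont.tendsto 0).mono_left nhdsWithin_le_nhds
  refine hlim.congr' ?_
  filter_upwards [self_mem_nhdsWithin] with t (ht : 0 < t)
  rw [Φ₂]
  field_simp

theorem norm_add_smul_le_Φ₁ {H : Type*} [NormedAddCommGroup H] [NormedSpace ℝ H] {K C : ℝ}
    (hK : 0 ≤ K) (hC : (K + 1) ^ 2 ≤ C) {x q : H} (hq : ‖q‖ ≤ K * ‖x‖ ^ 2)
    {s : ℝ} (hs : s ∈ Ioo (0 : ℝ) 1) :
    ‖x + (1 - s) • q‖ ≤ Φ₁ C ‖x‖ := by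
  have : 0 ≤ ‖x‖ := norm_nonneg x
  have hle : ‖x + (1 - s) • q‖ ≤ ‖x‖ + K * ‖x‖ ^ 2 := by
    refine (norm_add_le _ _).trans (add_le_add_right (le_trans ?_ hq) _)
    rw [norm_smul, Real.norm_of_nonneg (sub_nonneg.2 hs.2.le)]
    exact mul_le_of_le_one_left (norm_nonneg _) (by linarith [hs.1])
  refine hle.trans (Real.le_sqrt_of_sq_le ?_)
  calc (‖x‖ + K * ‖x‖ ^ 2) ^ 2 = ‖x‖ ^ 2 + 2 * K * ‖x‖ ^ 3 + K ^ 2 * ‖x‖ ^ 4 := by ring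
    _ ≤ ‖x‖ ^ 2 + C * ‖x‖ ^ 3 + C * ‖x‖ ^ 4 := by gcongr <;> nlinarith

/-! ### Quadratic energies along almost affine paths -/

/-- The maps `a` and `b` (the strains measured by the energy and by the dissipation) are almost
affine with constant `K`: `a` is controlled by `b`, and any two points are joined by a path along
which both maps deviate from affine interpolation by a multiple of `s (1 - s)` times the squared
distance of the end points.  Only the points of the path with `s ∈ (0, 1)` are recorded. -/
structure IsAlmostAffine {X H : Type*} [NormedAddCommGroup H] [NormedSpace ℝ H]
    (a b : X → H) (K : ℝ) : Prop where
  nonneg : 0 ≤ K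
  norm_sub_le : ∀ u v, ‖a u - a v‖ ≤ K * ‖b u - b v‖
  exists_path : ∀ u v, ∃ p q : H, ‖p‖ ≤ K * ‖b u - b v‖ ^ 2 ∧ ‖q‖ ≤ K * ‖b u - b v‖ ^ 2 ∧
    ∀ s ∈ Ioo (0 : ℝ) 1, ∃ z, a z = a u + s • (a v - a u) - (s * (1 - s)) • p ∧
      b z = b u + s • (b v - b u) - (s * (1 - s)) • q

/-- The local slope of the energy `½‖a ·‖²` for the distance `‖b u - b v‖`. -/
def quadraticSlope {X H : Type*} [NormedAddCommGroup H] (a b : X → H) : X → ℝ≥0∞ :=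
  localSlope (fun u v => ‖b u - b v‖) (fun u => 1 / 2 * ‖a u‖ ^ 2)

section InnerProduct

variable {H : Type*} [NormedAddCommGroup H] [InnerProductSpace ℝ H]

theorem half_norm_sq_sub (x y : H) :
    1 / 2 * ‖x‖ ^ 2 - 1 / 2 * ‖y‖ ^ 2 = inner ℝ (x - y) x - 1 / 2 * ‖x - y‖ ^ 2 := by
  rw [norm_sub_sq_real, inner_sub_left, real_inner_self_eq_norm_sq, real_inner_comm]
  ring

theorem half_norm_sq_add_smul_sub_le (x y : H) {s : ℝ} (hs : s ∈ Ioo (0 : ℝ) 1) :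
    1 / 2 * ‖x + s • (y - x)‖ ^ 2 ≤
      1 / 2 * ‖x‖ ^ 2 + s * (1 / 2 * ‖y‖ ^ 2 - 1 / 2 * ‖x‖ ^ 2) := by
  have hy : ‖y‖ ^ 2 = ‖x‖ ^ 2 + 2 * inner ℝ x (y - x) + ‖y - x‖ ^ 2 := by
    rw [← norm_add_sq_real, add_sub_cancel]
  rw [norm_add_sq_real, inner_smul_right, norm_smul, mul_pow, Real.norm_eq_abs, sq_abs, hy]
  nlinarith [mul_nonneg (mul_pos hs.1 (sub_pos.2 hs.2)).le (sq_nonneg ‖y - x‖)]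

theorem half_norm_sq_path_le (x y p : H) {s : ℝ} (hs : s ∈ Ioo (0 : ℝ) 1) :
    1 / 2 * ‖x + s • (y - x) - (s * (1 - s)) • p‖ ^ 2 ≤ 1 / 2 * ‖x‖ ^ 2
      + s * (1 / 2 * ‖y‖ ^ 2 - 1 / 2 * ‖x‖ ^ 2 + (‖x‖ + ‖y - x‖) * ‖p‖ + 1 / 2 * ‖p‖ ^ 2) := by
  obtain ⟨hs0, hs1⟩ := hs
  have hσ0 : 0 ≤ s * (1 - s) := mul_nonneg hs0.le (sub_nonneg.2 hs1.le)
  have hσs : s * (1 - s) ≤ s := by nlinarith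
  have hσ1 : s * (1 - s) ≤ 1 := hσs.trans hs1.le
  have hnorm : ‖x + s • (y - x)‖ ≤ ‖x‖ + ‖y - x‖ := by
    refine (norm_add_le _ _).trans (add_le_add_right ?_ _)
    rw [norm_smul, Real.norm_of_nonneg hs0.le]
    exact mul_le_of_le_one_left (norm_nonneg _) hs1.le
  have hcross : -inner ℝ (x + s • (y - x)) p ≤ (‖x‖ + ‖y - x‖) * ‖p‖ :=
    ((neg_le_abs _).trans (abs_real_inner_le_norm _ p)).trans (by gcongr)
  calc 1 / 2 * ‖x + s • (y - x) - (s * (1 - s)) • p‖ ^ 2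
      = 1 / 2 * ‖x + s • (y - x)‖ ^ 2 + s * (1 - s) * -inner ℝ (x + s • (y - x)) p
          + s * (1 - s) * (s * (1 - s)) * (1 / 2 * ‖p‖ ^ 2) := by
        rw [norm_sub_sq_real, inner_smul_right, norm_smul, Real.norm_of_nonneg hσ0]
        ring
    _ ≤ 1 / 2 * ‖x‖ ^ 2 + s * (1 / 2 * ‖y‖ ^ 2 - 1 / 2 * ‖x‖ ^ 2)
          + s * ((‖x‖ + ‖y - x‖) * ‖p‖) + s * 1 * (1 / 2 * ‖p‖ ^ 2) := by
        gcongr ?_ + ?_ + ?_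
        · exact half_norm_sq_add_smul_sub_le x y ⟨hs0, hs1⟩
        · exact (mul_le_mul_of_nonneg_left hcross hσ0).trans (by gcongr)
        · gcongr
    _ = _ := by ring

end InnerProduct

namespace IsAlmostAffine

section NormedSpace

variable {X H : Type*} [NormedAddCommGroup H] [NormedSpace ℝ H] {a b : X → H} {K : ℝ}

theorem eq_of_norm_sub_eq_zero (h : IsAlmostAffine a b K) {u v : X} (huv : ‖b u - b v‖ = 0) :
    a u = a v := by
  have hle := h.norm_sub_le u v
  rw [huv, mul_zero] at hle
  exact sub_eq_zero.1 (norm_le_zero_iff.1 hle)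

theorem abs_half_norm_sq_sub_le (h : IsAlmostAffine a b K) {N : ℝ} {u v : X} (hu : ‖a u‖ ≤ N)
    (hv : ‖a v‖ ≤ N) :
    |1 / 2 * ‖a u‖ ^ 2 - 1 / 2 * ‖a v‖ ^ 2| ≤ N * K * ‖b u - b v‖ := by
  have hN : 0 ≤ N := (norm_nonneg _).trans hu
  have hfactor : 1 / 2 * ‖a u‖ ^ 2 - 1 / 2 * ‖a v‖ ^ 2
      = (‖a u‖ + ‖a v‖) / 2 * (‖a u‖ - ‖a v‖) := by ring
  rw [hfactor, abs_mul, abs_of_nonneg (by positivity), mul_assoc]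
  exact mul_le_mul (by linarith) ((abs_norm_sub_norm_le _ _).trans (h.norm_sub_le u v))
    (abs_nonneg _) hN

end NormedSpace

variable {X H : Type*} [NormedAddCommGroup H] [InnerProductSpace ℝ H] {a b : X → H} {K C M : ℝ}

theorem energy_remainder_le (h : IsAlmostAffine a b K) (hC : (K + 1) ^ 2 ≤ C) {u v : X} {p : H}
    (hM : 1 / 2 * ‖a u‖ ^ 2 ≤ M) (hp : ‖p‖ ≤ K * ‖b u - b v‖ ^ 2) :
    (‖a u‖ + ‖a v - a u‖) * ‖p‖ + 1 / 2 * ‖p‖ ^ 2 ≤ Φ₂ C M ‖b u - b v‖ := by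
  have hK := h.nonneg
  have hav : ‖a v - a u‖ ≤ K * ‖b u - b v‖ := by rw [norm_sub_rev]; exact h.norm_sub_le u v
  have hM0 : 0 ≤ M := le_trans (by positivity) hM
  have hau : ‖a u‖ ≤ 2 * √M := by
    refine (abs_le_of_sq_le_sq' ?_ (by positivity)).2
    rw [mul_pow, Real.sq_sqrt hM0]
    linarith
  set d := ‖b u - b v‖
  have : 0 ≤ d := norm_nonneg _
  calc (‖a u‖ + ‖a v - a u‖) * ‖p‖ + 1 / 2 * ‖p‖ ^ 2
      ≤ (2 * √M + K * d) * (K * d ^ 2) + 1 / 2 * (K * d ^ 2) ^ 2 := by gcongr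
    _ = 2 * K * √M * d ^ 2 + K ^ 2 * d ^ 3 + 1 / 2 * K ^ 2 * d ^ 4 := by ring
    _ ≤ C * √M * d ^ 2 + C * d ^ 3 + C * d ^ 4 := by gcongr <;> nlinarith

theorem exists_descent (h : IsAlmostAffine a b K) (hC : (K + 1) ^ 2 ≤ C) {u : X}
    (hM : 1 / 2 * ‖a u‖ ^ 2 ≤ M) (v : X) {s : ℝ} (hs : s ∈ Ioo (0 : ℝ) 1) :
    ∃ z, s * (1 / 2 * ‖a u‖ ^ 2 - 1 / 2 * ‖a v‖ ^ 2 - Φ₂ C M ‖b u - b v‖)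
        ≤ 1 / 2 * ‖a u‖ ^ 2 - 1 / 2 * ‖a z‖ ^ 2 ∧
      ‖b u - b z‖ ≤ s * Φ₁ C ‖b u - b v‖ := by
  obtain ⟨p, q, hp, hq, hpath⟩ := h.exists_path u v
  obtain ⟨z, haz, hbz⟩ := hpath s hs
  refine ⟨z, ?_, ?_⟩
  · have hpathle := half_norm_sq_path_le (a u) (a v) p hs
    have hrem := mul_le_mul_of_nonneg_left (h.energy_remainder_le hC hM hp) hs.1.le
    rw [haz]
    linarith
  · have hsub : b u - b z = s • ((b u - b v) + (1 - s) • q) := by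
      rw [hbz, mul_smul]; module
    rw [hsub, norm_smul, Real.norm_of_nonneg hs.1.le]
    exact mul_le_mul_of_nonneg_left (norm_add_smul_le_Φ₁ h.nonneg hC hq hs) hs.1.le

theorem quadraticSlope_eq (h : IsAlmostAffine a b K) (hC : (K + 1) ^ 2 ≤ C) {u : X}
    (hM : 1 / 2 * ‖a u‖ ^ 2 ≤ M) :
    quadraticSlope a b u = ⨆ (v : X) (_ : u ≠ v), ENNReal.ofReal
      (max (1 / 2 * ‖a u‖ ^ 2 - 1 / 2 * ‖a v‖ ^ 2 - Φ₂ C M ‖b u - b v‖) 0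
        / Φ₁ C ‖b u - b v‖) := by
  refine le_antisymm (localSlope_le_iSup (tendsto_Φ₁_div C) (tendsto_Φ₂_div C M))
    (iSup₂_le fun v _ => ofReal_div_le_localSlope (fun _ => norm_nonneg _) (fun v hv => ?_)
      fun s hs => h.exists_descent hC hM v hs)
  rw [h.eq_of_norm_sub_eq_zero hv]

theorem quadraticSlope_le_liminf (h : IsAlmostAffine a b K) {ι : Type*} {F : Filter ι}
    {z : ι → X} {u : X} (hM : ∀ᶠ i in F, 1 / 2 * ‖a (z i)‖ ^ 2 ≤ M)
    (hrec : ∀ v, ∃ v' : ι → X,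
      Tendsto (fun i => 1 / 2 * ‖a (z i)‖ ^ 2 - 1 / 2 * ‖a (v' i)‖ ^ 2) F
        (𝓝 (1 / 2 * ‖a u‖ ^ 2 - 1 / 2 * ‖a v‖ ^ 2)) ∧
      Tendsto (fun i => ‖b (z i) - b (v' i)‖) F (𝓝 ‖b u - b v‖)) :
    quadraticSlope a b u ≤ liminf (fun i => quadraticSlope a b (z i)) F := by
  rcases F.eq_or_neBot with rfl | _
  · simp
  set M' := max M (1 / 2 * ‖a u‖ ^ 2)
  set C := (K + 1) ^ 2
  rw [h.quadraticSlope_eq (C := C) le_rfl (M := M') (le_max_right _ _)]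
  refine iSup₂_le fun v _ => ?_
  obtain ⟨v', henergy, hdist⟩ := hrec v
  rcases (norm_nonneg (b u - b v)).eq_or_lt' with h0 | h0
  · simp [h0, Φ₁]
  have hΦ₁pos : 0 < Φ₁ C ‖b u - b v‖ := by unfold Φ₁; positivity
  have hΦ₁ : Continuous (Φ₁ C) := by unfold Φ₁; fun_prop
  have hΦ₂ : Continuous (Φ₂ C M') := by unfold Φ₂; fun_prop
  have hlim := ENNReal.tendsto_ofReal
    (((henergy.sub ((hΦ₂.tendsto _).comp hdist)).max (tendsto_const_nhds (x := (0 : ℝ)))).div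
      ((hΦ₁.tendsto _).comp hdist) hΦ₁pos.ne')
  rw [← hlim.liminf_eq]
  refine liminf_le_liminf ?_
  filter_upwards [hM, hdist.eventually_const_lt h0] with i hi hi0
  rw [h.quadraticSlope_eq (C := C) le_rfl (M := M') (hi.trans (le_max_left _ _))]
  have hne : z i ≠ v' i := fun he => by simp [he] at hi0
  exact le_iSup₂ (f := fun (v : X) (_ : z i ≠ v) => ENNReal.ofReal
    (max (1 / 2 * ‖a (z i)‖ ^ 2 - 1 / 2 * ‖a v‖ ^ 2 - Φ₂ C M' ‖b (z i) - b v‖) 0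
      / Φ₁ C ‖b (z i) - b v‖)) (v' i) hne

end IsAlmostAffine

/-! ### Strong upper gradients -/

theorem absolutelyContinuousOnInterval_of_dist_le {f g : ℝ → ℝ} {s t C : ℝ}
    (hg : AbsolutelyContinuousOnInterval g s t)
    (hfg : ∀ x ∈ uIcc s t, ∀ y ∈ uIcc s t, dist (f x) (f y) ≤ C * dist (g x) (g y)) :
    AbsolutelyContinuousOnInterval f s t := by
  have hlim : Tendsto (fun E : ℕ × (ℕ → ℝ × ℝ) =>
      C * ∑ i ∈ Finset.range E.1, dist (g (E.2 i).1) (g (E.2 i).2))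
      (AbsolutelyContinuousOnInterval.totalLengthFilter ⊓
        𝓟 (AbsolutelyContinuousOnInterval.disjWithin s t)) (𝓝 0) := by
    simpa using Tendsto.const_mul C hg
  refine squeeze_zero' (Eventually.of_forall fun E => Finset.sum_nonneg fun _ _ => dist_nonneg) ?_
    hlim
  filter_upwards [mem_inf_of_right (mem_principal_self _)] with E hE
  rw [Finset.mul_sum]
  exact Finset.sum_le_sum fun i hi => hfg _ (hE.1 i hi).1 _ (hE.1 i hi).2

/-- `φ` is Lipschitz with respect to `D` on every `D`-ball.  This is what replaces continuity of
`φ` along curves, as well as the finiteness of its local slope, in the chain rule below. -/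
def IsLipschitzOnBalls {X : Type*} (D : X → X → ℝ) (φ : X → ℝ) : Prop :=
  ∀ u R, ∃ L, 0 ≤ L ∧ ∀ v w, D u v ≤ R → D u w ≤ R → |φ v - φ w| ≤ L * D v w

section Metric

variable {X : Type*} {D : X → X → ℝ} {φ : X → ℝ} {γ : ℝ → X} {J : Set ℝ} {m : ℝ → ℝ}

namespace IsLipschitzOnBalls

theorem eq_of_eq_zero (hφ : IsLipschitzOnBalls D φ) (hself : ∀ u, D u u = 0) {u v : X}
    (huv : D u v = 0) : φ u = φ v := by
  obtain ⟨L, -, hL⟩ := hφ u 0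
  have hle := hL u v (hself u).le huv.le
  rw [huv, mul_zero] at hle
  exact sub_eq_zero.1 (abs_nonpos_iff.1 hle)

theorem localSlope_ne_top (hφ : IsLipschitzOnBalls D φ) (hself : ∀ u, D u u = 0)
    (hnonneg : ∀ u v, 0 ≤ D u v) (u : X) : localSlope D φ u ≠ ⊤ := by
  obtain ⟨L, hL0, hL⟩ := hφ u 1
  refine ne_top_of_le_ne_top (ENNReal.ofReal_ne_top (r := L))
    (limsup_le_of_le (by isBoundedDefault) ?_)
  filter_upwards [mem_inf_of_left (preimage_mem_comap (Iic_mem_nhds one_pos))] with z hz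
  refine ENNReal.ofReal_le_ofReal (div_le_of_le_mul₀ (hnonneg _ _) hL0 (max_le ?_ ?_))
  · exact (le_abs_self _).trans (hL u z ((hself u).trans_le zero_le_one) hz)
  · exact mul_nonneg hL0 (hnonneg _ _)

theorem enorm_deriv_le_of_eventually_lt (hφ : IsLipschitzOnBalls D φ) (hself : ∀ u, D u u = 0)
    (hnonneg : ∀ u v, 0 ≤ D u v) (hsymm : ∀ u v, D u v = D v u) {r d : ℝ}
    (hd : HasDerivAt (φ ∘ γ) d r) (hcont : Tendsto (fun s => D (γ r) (γ s)) (𝓝[≠] r) (𝓝 0))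
    (hfin : metricDeriv D γ r ≠ ⊤) {F : Filter ℝ} [F.NeBot] (hF : F ≤ 𝓝[≠] r)
    (hlt : ∀ᶠ s in F, φ (γ s) < φ (γ r)) :
    ‖d‖ₑ ≤ localSlope D φ (γ r) * metricDeriv D γ r := by
  set p : X → ℝ≥0∞ := fun z => ENNReal.ofReal (max (φ (γ r) - φ z) 0 / D (γ r) z) with hp
  set q : ℝ → ℝ≥0∞ := fun s => ENNReal.ofReal (D (γ s) (γ r) / |s - r|) with hq
  have hlim : Tendsto (fun s => ‖slope (φ ∘ γ) r s‖ₑ) F (𝓝 ‖d‖ₑ) :=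
    ((hasDerivAt_iff_tendsto_slope.1 hd).mono_left hF).enorm
  have hfactor : (fun s => ‖slope (φ ∘ γ) r s‖ₑ) =ᶠ[F] (p ∘ γ) * q := by
    filter_upwards [hlt, hF self_mem_nhdsWithin] with s hs hsr
    have hD : 0 < D (γ r) (γ s) :=
      (hnonneg _ _).lt_of_ne' fun h0 => hs.ne' (hφ.eq_of_eq_zero hself h0)
    have : 0 < |s - r| := abs_pos.2 (sub_ne_zero.2 hsr)
    rw [Pi.mul_apply, Function.comp_apply, hp, hq, ← ENNReal.ofReal_mul (by positivity),
      hsymm (γ s), ← ofReal_norm, slope_def_field, Real.norm_eq_abs, abs_div,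
      Function.comp_apply, Function.comp_apply, abs_sub_comm (φ (γ s)), abs_of_pos (sub_pos.2 hs),
      max_eq_left (sub_pos.2 hs).le, div_mul_div_cancel₀ hD.ne']
  have hγ : Tendsto γ F (comap (D (γ r)) (𝓝 0) ⊓ 𝓟 {γ r}ᶜ) := by
    refine tendsto_inf.2 ⟨tendsto_comap_iff.2 (hcont.mono_left hF), tendsto_principal.2 ?_⟩
    filter_upwards [hlt] with s hs he
    exact hs.ne (congrArg φ he)
  have hp_le : limsup (p ∘ γ) F ≤ localSlope D φ (γ r) := limsup_le_limsup_of_le (u := p) hγ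
  have hq_le : limsup q F ≤ metricDeriv D γ r := limsup_le_limsup_of_le hF
  rw [← hlim.limsup_eq, limsup_congr hfactor]
  exact (ENNReal.limsup_mul_le' (Or.inr (ne_top_of_le_ne_top hfin hq_le))
    (Or.inl (ne_top_of_le_ne_top (hφ.localSlope_ne_top hself hnonneg _) hp_le))).trans
      (mul_le_mul' hp_le hq_le)

theorem enorm_deriv_le (hφ : IsLipschitzOnBalls D φ) (hself : ∀ u, D u u = 0)
    (hnonneg : ∀ u v, 0 ≤ D u v) (hsymm : ∀ u v, D u v = D v u) {r d : ℝ}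
    (hd : HasDerivAt (φ ∘ γ) d r) (hcont : Tendsto (fun s => D (γ r) (γ s)) (𝓝[≠] r) (𝓝 0))
    (hfin : metricDeriv D γ r ≠ ⊤) :
    ‖d‖ₑ ≤ localSlope D φ (γ r) * metricDeriv D γ r := by
  have hslope := hasDerivAt_iff_tendsto_slope.1 hd
  rcases lt_trichotomy d 0 with hd0 | rfl | hd0
  · have hF : 𝓝[>] r ≤ 𝓝[≠] r := nhdsWithin_mono _ fun s hs => ne_of_gt hs
    refine hφ.enorm_deriv_le_of_eventually_lt hself hnonneg hsymm hd hcont hfin hF ?_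
    filter_upwards [(hslope.mono_left hF).eventually_lt_const hd0, self_mem_nhdsWithin]
      with s hs hrs
    exact (slope_neg_iff_of_le (f := φ ∘ γ) (le_of_lt hrs)).1 hs
  · simp
  · have hF : 𝓝[<] r ≤ 𝓝[≠] r := nhdsWithin_mono _ fun s hs => ne_of_lt hs
    refine hφ.enorm_deriv_le_of_eventually_lt hself hnonneg hsymm hd hcont hfin hF ?_
    filter_upwards [(hslope.mono_left hF).eventually_const_lt hd0, self_mem_nhdsWithin]
      with s hs hrs
    rw [slope_comm] at hs
    exact (slope_pos_iff_of_le (f := φ ∘ γ) (le_of_lt hrs)).1 hs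

end IsLipschitzOnBalls

theorem IsACCurve.exists_integrable (hsymm : ∀ u v, D u v = D v u) (hJo : IsOpen J)
    (hJ : J.OrdConnected) (hγ : IsACCurve D J γ) :
    ∃ m : ℝ → ℝ, Integrable m ∧
      ∀ s ∈ J, ∀ t ∈ J, D (γ s) (γ t) ≤ |∫ r in s..t, m r| := by
  obtain ⟨m, hm, hD⟩ := hγ
  refine ⟨J.indicator m, hm.integrable_indicator hJo.measurableSet, ?_⟩
  have hle : ∀ s ∈ J, ∀ t ∈ J, s ≤ t → D (γ s) (γ t) ≤ ∫ r in s..t, J.indicator m r := by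
    intro s hs t ht hst
    refine (hD s hs t ht hst).trans_eq (intervalIntegral.integral_congr fun r hr => ?_)
    exact (indicator_of_mem (hJ.uIcc_subset hs ht hr) m).symm
  intro s hs t ht
  rcases le_total s t with hst | hst
  · exact (hle s hs t ht hst).trans (le_abs_self _)
  · rw [hsymm, intervalIntegral.integral_symm, abs_neg]
    exact (hle t ht s hs hst).trans (le_abs_self _)

theorem tendsto_dist_of_le_integral (hnonneg : ∀ u v, 0 ≤ D u v) (hJo : IsOpen J)
    (hm : Integrable m) (hD : ∀ s ∈ J, ∀ t ∈ J, D (γ s) (γ t) ≤ |∫ r in s..t, m r|) {t : ℝ}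
    (ht : t ∈ J) : Tendsto (fun s => D (γ t) (γ s)) (𝓝 t) (𝓝 0) := by
  have hcont : Continuous fun s => |∫ r in t..s, m r| :=
    (intervalIntegral.continuous_primitive (fun _ _ => hm.intervalIntegrable) t).abs
  refine squeeze_zero' (Eventually.of_forall fun s => hnonneg _ _) ?_
    (by simpa using hcont.tendsto t)
  filter_upwards [hJo.mem_nhds ht] with s hs using hD t ht s hs

theorem ae_metricDeriv_ne_top (hJo : IsOpen J) (hm : Integrable m)
    (hD : ∀ s ∈ J, ∀ t ∈ J, D (γ s) (γ t) ≤ |∫ r in s..t, m r|) :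
    ∀ᵐ t, t ∈ J → metricDeriv D γ t ≠ ⊤ := by
  filter_upwards [LocallyIntegrable.ae_hasDerivAt_integral hm.locallyIntegrable] with t ht htJ
  have hlim := ((hasDerivAt_iff_tendsto_slope.1 (ht 0)).enorm).limsup_eq
  refine ne_top_of_le_ne_top (enorm_ne_top (x := m t)) (hlim ▸ limsup_le_limsup ?_)
  filter_upwards [nhdsWithin_le_nhds (hJo.mem_nhds htJ)] with s hs
  rw [← ofReal_norm, slope_def_field, Real.norm_eq_abs, abs_div, abs_sub_comm (∫ r in 0..s, m r),
    intervalIntegral.integral_interval_sub_left hm.intervalIntegrable hm.intervalIntegrable]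
  gcongr
  exact hD s hs t htJ

theorem IsLipschitzOnBalls.absolutelyContinuousOnInterval (hφ : IsLipschitzOnBalls D φ)
    (hJ : J.OrdConnected) (hm : Integrable m)
    (hD : ∀ s ∈ J, ∀ t ∈ J, D (γ s) (γ t) ≤ |∫ r in s..t, m r|) {s t : ℝ} (hs : s ∈ J)
    (ht : t ∈ J) : AbsolutelyContinuousOnInterval (φ ∘ γ) s t := by
  have hsub : uIcc s t ⊆ J := hJ.uIcc_subset hs ht
  have hcont : Continuous fun x => |∫ r in s..x, m r| :=
    (intervalIntegral.continuous_primitive (fun _ _ => hm.intervalIntegrable) s).abs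
  obtain ⟨R, hR⟩ := (isCompact_uIcc (a := s) (b := t)).bddAbove_image hcont.continuousOn
  have hball : ∀ x ∈ uIcc s t, D (γ s) (γ x) ≤ R := fun x hx =>
    (hD s hs x (hsub hx)).trans (hR (mem_image_of_mem _ hx))
  obtain ⟨L, hL0, hL⟩ := hφ (γ s) R
  refine absolutelyContinuousOnInterval_of_dist_le (C := L)
    (hm.intervalIntegrable.absolutelyContinuousOnInterval_intervalIntegral left_mem_uIcc) ?_
  intro x hx y hy
  rw [dist_comm (∫ r in s..x, m r), Real.dist_eq, Real.dist_eq,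
    intervalIntegral.integral_interval_sub_left hm.intervalIntegrable hm.intervalIntegrable]
  exact (hL _ _ (hball x hx) (hball y hy)).trans
    (mul_le_mul_of_nonneg_left (hD x (hsub hx) y (hsub hy)) hL0)

theorem IsLipschitzOnBalls.isStrongUpperGradient (hφ : IsLipschitzOnBalls D φ)
    (hself : ∀ u, D u u = 0) (hnonneg : ∀ u v, 0 ≤ D u v) (hsymm : ∀ u v, D u v = D v u)
    (hlsc : ∀ u, localSlope D φ u ≤ liminf (localSlope D φ) (comap (D u) (𝓝 0))) :
    IsStrongUpperGradient D φ (localSlope D φ) := by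
  intro J γ hJo hJ hγ
  obtain ⟨m, hm, hD⟩ := hγ.exists_integrable hsymm hJo hJ
  have hcont : ∀ t ∈ J, Tendsto (fun s => D (γ t) (γ s)) (𝓝 t) (𝓝 0) := fun t ht =>
    tendsto_dist_of_le_integral hnonneg hJo hm hD ht
  refine ⟨LowerSemicontinuous.measurable fun t => lowerSemicontinuousAt_iff_le_liminf.2 ?_, ?_⟩
  · have hγt : Tendsto (fun s : J => γ s) (𝓝 t) (comap (D (γ t)) (𝓝 0)) :=
      tendsto_comap_iff.2 ((hcont t t.2).comp (continuous_subtype_val.tendsto t))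
    exact (hlsc (γ t)).trans (liminf_le_liminf_of_le (u := localSlope D φ) hγt)
  intro s hs t ht hst
  have hac := hφ.absolutelyContinuousOnInterval hJ hm hD hs ht
  have hsub : Ioo s t ⊆ J := Ioo_subset_Icc_self.trans (hJ.out hs ht)
  have hint : φ (γ t) - φ (γ s) = ∫ r in Ioo s t, deriv (φ ∘ γ) r := by
    rw [← integral_Ioc_eq_integral_Ioo, ← intervalIntegral.integral_of_le hst,
      hac.integral_deriv_eq_sub, Function.comp_apply, Function.comp_apply]
  rw [hint, ← Real.norm_eq_abs, ofReal_norm]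
  refine (enorm_integral_le_lintegral_enorm _).trans (lintegral_mono_ae ?_)
  rw [ae_restrict_iff' measurableSet_Ioo]
  filter_upwards [hac.ae_differentiableAt, ae_metricDeriv_ne_top hJo hm hD] with r hdiff hfin hr
  have hr' : r ∈ uIcc s t := Icc_subset_uIcc (Ioo_subset_Icc_self hr)
  exact hφ.enorm_deriv_le hself hnonneg hsymm (hdiff hr').hasDerivAt
    ((hcont r (hsub hr)).mono_left nhdsWithin_le_nhds) (hfin (hsub hr))

end Metric

theorem IsAlmostAffine.isLipschitzOnBalls {X H : Type*} [NormedAddCommGroup H] [NormedSpace ℝ H]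
    {a b : X → H} {K : ℝ} (h : IsAlmostAffine a b K) :
    IsLipschitzOnBalls (fun u v => ‖b u - b v‖) (fun u => 1 / 2 * ‖a u‖ ^ 2) := by
  intro u R
  have hnorm : ∀ v, ‖b u - b v‖ ≤ R → ‖a v‖ ≤ ‖a u‖ + K * max R 0 := fun v hv => by
    have hdist := (h.norm_sub_le u v).trans
      (mul_le_mul_of_nonneg_left (hv.trans (le_max_left R 0)) h.nonneg)
    rw [norm_sub_rev] at hdist
    linarith [norm_le_norm_add_norm_sub' (a v) (a u)]
  have hK := h.nonneg
  exact ⟨(‖a u‖ + K * max R 0) * K, by positivity, fun v w hv hw =>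
    h.abs_half_norm_sq_sub_le (hnorm v hv) (hnorm w hw)⟩

theorem IsAlmostAffine.isStrongUpperGradient_quadraticSlope {X H : Type*} [NormedAddCommGroup H]
    [NormedSpace ℝ H] {a b : X → H} {K : ℝ} (h : IsAlmostAffine a b K)
    (hlsc : ∀ u, quadraticSlope a b u ≤
      liminf (quadraticSlope a b) (comap (fun v => ‖b u - b v‖) (𝓝 0))) :
    IsStrongUpperGradient (fun u v => ‖b u - b v‖) (fun u => 1 / 2 * ‖a u‖ ^ 2)
      (quadraticSlope a b) :=
  h.isLipschitzOnBalls.isStrongUpperGradient (fun u => by rw [sub_self, norm_zero])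
    (fun _ _ => norm_nonneg _) (fun _ _ => norm_sub_rev _ _) hlsc

/-! ### Weak derivatives on an interval -/

section Interval

variable {c d : ℝ} {f f' : ℝ → ℝ}

theorem integrableOn_Ioo_mul_continuous (hf : IntegrableOn f (Ioo c d)) {ψ : ℝ → ℝ}
    (hψ : Continuous ψ) : IntegrableOn (fun x => f x * ψ x) (Ioo c d) :=
  hf.mul_continuousOn_of_subset hψ.continuousOn measurableSet_Ioo isCompact_Icc Ioo_subset_Icc_self

theorem absolutelyContinuousOnInterval_primitive_add_const (hcd : c ≤ d)
    (hf : IntegrableOn f (Ioo c d)) (k : ℝ) :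
    AbsolutelyContinuousOnInterval (fun x => (∫ r in c..x, f r) + k) c d :=
  (((intervalIntegrable_iff_integrableOn_Ioo_of_le hcd).2
    hf).absolutelyContinuousOnInterval_intervalIntegral left_mem_uIcc).add
    contDiffOn_const.absolutelyContinuousOnInterval

theorem integrableOn_primitive (hcd : c ≤ d) (hf : IntegrableOn f (Ioo c d)) :
    IntegrableOn (fun x => ∫ r in c..x, f r) (Ioo c d) := by
  have hcont := (absolutelyContinuousOnInterval_primitive_add_const hcd hf 0).continuousOn
  rw [uIcc_of_le hcd] at hcont
  simpa using hcont.integrableOn_Icc.mono_set Ioo_subset_Icc_self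

theorem setIntegral_primitive_add_const_mul_deriv (hcd : c ≤ d) (hf : IntegrableOn f (Ioo c d))
    (k : ℝ) {φ : ℝ → ℝ} (hφ : ContDiff ℝ ∞ φ) :
    ∫ x in Ioo c d, (((∫ r in c..x, f r) + k) * deriv φ x + f x * φ x)
      = ((∫ r in c..d, f r) + k) * φ d - k * φ c := by
  have hparts := (absolutelyContinuousOnInterval_primitive_add_const hcd hf
    k).integral_deriv_mul_eq_sub (hφ.of_le (by simp)).contDiffOn.absolutelyContinuousOnInterval
  rw [intervalIntegral.integral_same, zero_add] at hparts
  rw [← hparts, ← integral_Ioc_eq_integral_Ioo, ← intervalIntegral.integral_of_le hcd]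
  refine intervalIntegral.integral_congr_ae ?_
  filter_upwards [((intervalIntegrable_iff_integrableOn_Ioo_of_le hcd).2
    hf).ae_hasDerivAt_integral] with x hx hxm
  rw [((hx (uIoc_subset_uIcc hxm) c left_mem_uIcc).add_const k).deriv, add_comm]

theorem exists_Icc_subset_Ioo {K : Set ℝ} (hK : IsCompact K) (hKcd : K ⊆ Ioo c d) :
    ∃ a b, K ⊆ Icc a b ∧ Icc a b ⊆ Ioo c d := by
  rcases K.eq_empty_or_nonempty with rfl | hne
  · exact ⟨1, 0, empty_subset _, by simp⟩
  · exact ⟨sInf K, sSup K, subset_Icc_csInf_csSup hK.bddBelow hK.bddAbove,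
      Icc_subset_Ioo (hKcd (hK.sInf_mem hne)).1 (hKcd (hK.sSup_mem hne)).2⟩

theorem support_primitive_subset {η : ℝ → ℝ} {a b : ℝ} (hη : Function.support η ⊆ Icc a b)
    (h0 : ∫ x, η x = 0) (hca : c < a) :
    Function.support (fun x => ∫ r in c..x, η r) ⊆ Icc a b := by
  intro x hx
  contrapose! hx
  rw [Function.notMem_support]
  rcases lt_or_ge x a with hxa | hax
  · refine (intervalIntegral.integral_congr fun y hy => ?_).trans intervalIntegral.integral_zero
    exact Function.notMem_support.1 fun hyη =>
      (hy.2.trans_lt (max_lt hca hxa)).not_ge (hη hyη).1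
  · have hbx : b < x := lt_of_not_ge fun hxb => hx ⟨hax, hxb⟩
    rw [intervalIntegral.integral_eq_integral_of_support_subset, h0]
    exact hη.trans fun y hy => ⟨hca.trans_le hy.1, hy.2.trans hbx.le⟩

theorem exists_deriv_eq_of_integral_eq_zero {η : ℝ → ℝ} (hη : ContDiff ℝ ∞ η)
    (hηc : HasCompactSupport η) (hηs : tsupport η ⊆ Ioo c d) (h0 : ∫ x, η x = 0) :
    ∃ φ : ℝ → ℝ, ContDiff ℝ ∞ φ ∧ HasCompactSupport φ ∧ tsupport φ ⊆ Ioo c d ∧ deriv φ = η := by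
  obtain ⟨a, b, hab, hcd⟩ := exists_Icc_subset_Ioo hηc hηs
  rcases lt_or_ge b a with hba | hba
  · have hη0 : η = 0 := by
      rw [Icc_eq_empty hba.not_ge, subset_empty_iff, tsupport_eq_empty_iff] at hab
      exact hab
    exact ⟨0, contDiff_const, HasCompactSupport.zero, by simp [tsupport], by simp [hη0]⟩
  have hder : ∀ x, HasDerivAt (fun x => ∫ r in c..x, η r) (η x) x := fun x =>
    intervalIntegral.integral_hasDerivAt_right (hη.continuous.intervalIntegrable _ _)
      (hη.continuous.stronglyMeasurableAtFilter _ _) hη.continuous.continuousAt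
  have hderiv : deriv (fun x => ∫ r in c..x, η r) = η := funext fun x => (hder x).deriv
  have hsupp := support_primitive_subset ((subset_tsupport η).trans hab) h0
    (hcd (left_mem_Icc.2 hba)).1
  exact ⟨_, contDiff_infty_iff_deriv.2 ⟨fun x => (hder x).differentiableAt, hderiv.symm ▸ hη⟩,
    HasCompactSupport.of_support_subset_isCompact isCompact_Icc hsupp,
    (closure_minimal hsupp isClosed_Icc).trans hcd, hderiv⟩

theorem exists_test_integral_eq_one (hcd : c < d) :
    ∃ ρ : ℝ → ℝ, ContDiff ℝ ∞ ρ ∧ HasCompactSupport ρ ∧ tsupport ρ ⊆ Ioo c d ∧ ∫ x, ρ x = 1 := by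
  let B : ContDiffBump ((c + d) / 2) := ⟨(d - c) / 8, (d - c) / 4, by linarith, by linarith⟩
  refine ⟨B.normed volume, B.contDiff_normed, B.hasCompactSupport_normed, ?_, B.integral_normed⟩
  rw [B.tsupport_normed_eq, Real.closedBall_eq_Icc]
  exact Icc_subset_Ioo (by change c < (c + d) / 2 - (d - c) / 4; linarith)
    (by change (c + d) / 2 + (d - c) / 4 < d; linarith)

theorem setIntegral_mul_eq_of_integral_mul_deriv_eq_zero (hf : IntegrableOn f (Ioo c d))
    (h : ∀ φ : ℝ → ℝ, ContDiff ℝ ∞ φ → HasCompactSupport φ → tsupport φ ⊆ Ioo c d →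
      ∫ x in Ioo c d, f x * deriv φ x = 0)
    {ρ ψ : ℝ → ℝ} (hρ : ContDiff ℝ ∞ ρ) (hρc : HasCompactSupport ρ) (hρs : tsupport ρ ⊆ Ioo c d)
    (hρ1 : ∫ x, ρ x = 1) (hψ : ContDiff ℝ ∞ ψ) (hψc : HasCompactSupport ψ)
    (hψs : tsupport ψ ⊆ Ioo c d) :
    ∫ x in Ioo c d, f x * ψ x = (∫ x in Ioo c d, f x * ρ x) * ∫ x, ψ x := by
  have hψi : Integrable ψ := hψ.continuous.integrable_of_hasCompactSupport hψc
  have hρi : Integrable ρ := hρ.continuous.integrable_of_hasCompactSupport hρc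
  obtain ⟨φ, hφ, hφc, hφs, hφ'⟩ := exists_deriv_eq_of_integral_eq_zero
    (η := fun x => ψ x - ρ x * ∫ y, ψ y) (hψ.sub (hρ.mul contDiff_const))
    (hψc.sub hρc.mul_right)
    ((tsupport_sub ψ _).trans (union_subset hψs ((tsupport_mul_subset_left).trans hρs)))
    (by rw [integral_sub hψi (hρi.mul_const _), integral_mul_const, hρ1, one_mul, sub_self])
  have hφ0 := h φ hφ hφc hφs
  simp only [hφ', mul_sub, ← mul_assoc] at hφ0
  rwa [integral_sub (integrableOn_Ioo_mul_continuous hf hψ.continuous)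
    ((integrableOn_Ioo_mul_continuous hf hρ.continuous).mul_const _), integral_mul_const,
    sub_eq_zero] at hφ0

theorem exists_ae_eq_const_of_integral_mul_deriv_eq_zero (hcd : c < d)
    (hf : IntegrableOn f (Ioo c d))
    (h : ∀ φ : ℝ → ℝ, ContDiff ℝ ∞ φ → HasCompactSupport φ → tsupport φ ⊆ Ioo c d →
      ∫ x in Ioo c d, f x * deriv φ x = 0) :
    ∃ k, ∀ᵐ x ∂volume.restrict (Ioo c d), f x = k := by
  obtain ⟨ρ, hρ, hρc, hρs, hρ1⟩ := exists_test_integral_eq_one hcd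
  set k := ∫ x in Ioo c d, f x * ρ x
  refine ⟨k, (ae_restrict_iff' measurableSet_Ioo).2 ?_⟩
  have hfk : IntegrableOn (fun x => f x - k) (Ioo c d) := hf.sub (integrableOn_const (by simp))
  have hzero : ∀ᵐ x, x ∈ Ioo c d → f x - k = 0 := by
    refine isOpen_Ioo.ae_eq_zero_of_integral_contDiff_smul_eq_zero hfk.locallyIntegrableOn
      fun ψ hψ hψc hψs => ?_
    have hvanish : ∀ x ∉ Ioo c d, ψ x = 0 := fun x hx =>
      image_eq_zero_of_notMem_tsupport fun hxψ => hx (hψs hxψ)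
    rw [← setIntegral_eq_integral_of_forall_compl_eq_zero (s := Ioo c d) fun x hx => by
      rw [hvanish x hx, zero_smul]]
    simp only [smul_eq_mul, mul_comm (ψ _), sub_mul]
    rw [integral_sub (integrableOn_Ioo_mul_continuous hf hψ.continuous)
      ((hψ.continuous.integrable_of_hasCompactSupport hψc).integrableOn.const_mul _),
      integral_const_mul,
      setIntegral_mul_eq_of_integral_mul_deriv_eq_zero hf h hρ hρc hρs hρ1 hψ hψc hψs,
      setIntegral_eq_integral_of_forall_compl_eq_zero hvanish, sub_self]
  filter_upwards [hzero] with x hx hxI using sub_eq_zero.1 (hx hxI)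

theorem HasWeakDeriv.exists_ae_eq_primitive_add_const (hcd : c < d)
    (hf : IntegrableOn f (Ioo c d)) (hf' : IntegrableOn f' (Ioo c d))
    (h : HasWeakDeriv (Ioo c d) 1 f f') :
    ∃ k, ∀ᵐ x ∂volume.restrict (Ioo c d), f x = (∫ r in c..x, f' r) + k := by
  have hG := integrableOn_primitive hcd.le hf'
  obtain ⟨k, hk⟩ := exists_ae_eq_const_of_integral_mul_deriv_eq_zero hcd
    (f := fun x => f x - ∫ r in c..x, f' r) (hf.sub hG) fun φ hφ hφc hφs => by
      have hφ' : Continuous (deriv φ) := hφ.continuous_deriv (by simp)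
      have hweak := h φ hφ hφc hφs
      have hparts := setIntegral_primitive_add_const_mul_deriv hcd.le hf' 0 hφ
      have hφd : φ d = 0 := image_eq_zero_of_notMem_tsupport fun hd => lt_irrefl d (hφs hd).2
      simp only [fderiv_apply_one_eq_deriv] at hweak
      simp only [add_zero, zero_mul, sub_zero, hφd, mul_zero] at hparts
      rw [integral_add (integrableOn_Ioo_mul_continuous hG hφ')
        (integrableOn_Ioo_mul_continuous hf' hφ.continuous)] at hparts
      simp only [sub_mul]
      rw [integral_sub (integrableOn_Ioo_mul_continuous hf hφ')
        (integrableOn_Ioo_mul_continuous hG hφ'), hweak]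
      linarith
  refine ⟨k, ?_⟩
  filter_upwards [hk] with x hx using sub_eq_iff_eq_add'.1 hx

theorem HasZeroTrace.hasWeakDeriv (hf : IntegrableOn f (Ioo c d)) (hf' : IntegrableOn f' (Ioo c d))
    (h : HasZeroTrace (Ioo c d) 1 f f') : HasWeakDeriv (Ioo c d) 1 f f' := by
  intro φ hφ hφc _
  rw [← add_eq_zero_iff_eq_neg, ← integral_add
    (integrableOn_Ioo_mul_continuous hf (continuous_dirDeriv hφ))
    (integrableOn_Ioo_mul_continuous hf' hφ.continuous)]
  exact h φ hφ hφc

theorem HasZeroTrace.ae_eq_primitive (hcd : c < d) (hf : IntegrableOn f (Ioo c d))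
    (hf' : IntegrableOn f' (Ioo c d)) (h : HasZeroTrace (Ioo c d) 1 f f') :
    ∀ᵐ x ∂volume.restrict (Ioo c d), f x = ∫ r in c..x, f' r := by
  obtain ⟨k, hk⟩ := (h.hasWeakDeriv hf hf').exists_ae_eq_primitive_add_const hcd hf hf'
  let B : ContDiffBump c := ⟨(d - c) / 3, (d - c) / 2, by linarith, by linarith⟩
  have hBc : B c = 1 := B.one_of_mem_closedBall (Metric.mem_closedBall_self B.rIn_pos.le)
  have hBd : B d = 0 := B.zero_of_le_dist (by
    change (d - c) / 2 ≤ dist d c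
    rw [Real.dist_eq, abs_of_pos (sub_pos.2 hcd)]
    linarith)
  have hparts := setIntegral_primitive_add_const_mul_deriv hcd.le hf' k B.contDiff
  have hB : ∫ x in Ioo c d, (((∫ r in c..x, f' r) + k) * deriv B x + f' x * B x) = 0 := by
    rw [← h B B.contDiff B.hasCompactSupport]
    refine integral_congr_ae ?_
    filter_upwards [hk] with x hx
    rw [hx, fderiv_apply_one_eq_deriv]
  have hk0 : k = 0 := by simpa [hB, hBc, hBd] using hparts
  simpa [hk0] using hk

end Interval

section L2

variable {l : ℝ}

instance isFiniteMeasure_restrict_I : IsFiniteMeasure (volume.restrict (I l)) := ⟨by simp [I]⟩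

theorem integrableOn_L2I (f : L2I l) : IntegrableOn f (I l) :=
  (Lp.memLp f).integrable one_le_two

theorem measureReal_univ_restrict_I (hl : 0 ≤ l) : (volume.restrict (I l)).real univ = l := by
  simp [I, Measure.real, hl]

/-- The indicator function of `(-l/2, x]` in `L²(I)`; pairing with it evaluates at `x` the
primitive that vanishes at `-l/2`. -/
def leftIndicator (l x : ℝ) : L2I l :=
  indicatorConstLp 2 (measurableSet_Ioc (a := -(l / 2)) (b := x)) (measure_ne_top _ _) 1

theorem norm_leftIndicator_le (hl : 0 ≤ l) (x : ℝ) : ‖leftIndicator l x‖ ≤ √l := by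
  refine norm_indicatorConstLp_le.trans ?_
  rw [norm_one, one_mul, ENNReal.toReal_ofNat, ← Real.sqrt_eq_rpow]
  exact Real.sqrt_le_sqrt
    ((measureReal_mono (subset_univ _)).trans_eq (measureReal_univ_restrict_I hl))

theorem inner_leftIndicator (f : L2I l) {x : ℝ} (hx : x ∈ I l) :
    inner ℝ (leftIndicator l x) f = ∫ r in (-(l / 2))..x, f r := by
  rw [leftIndicator, L2.inner_indicatorConstLp_one, intervalIntegral.integral_of_le hx.1.le,
    Measure.restrict_restrict measurableSet_Ioc, inter_eq_left.2]
  exact fun y hy => ⟨hy.1, hy.2.trans_lt hx.2⟩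

theorem abs_inner_leftIndicator_le (hl : 0 ≤ l) (x : ℝ) (f : L2I l) :
    |inner ℝ (leftIndicator l x) f| ≤ √l * ‖f‖ :=
  (abs_real_inner_le_norm _ _).trans (by gcongr; exact norm_leftIndicator_le hl x)

theorem HasZeroTrace.ae_eq_inner (hl : 0 < l) {f f' : L2I l} (h : HasZeroTrace (I l) 1 f f') :
    ∀ᵐ x ∂volume.restrict (I l), f x = inner ℝ (leftIndicator l x) f' := by
  filter_upwards [HasZeroTrace.ae_eq_primitive (neg_lt_self (half_pos hl)) (integrableOn_L2I f)
    (integrableOn_L2I f') h, ae_restrict_mem measurableSet_Ioo] with x hx hxI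
  rw [hx, inner_leftIndicator f' hxI]

theorem HasZeroTrace.ae_abs_le (hl : 0 < l) {f f' : L2I l} (h : HasZeroTrace (I l) 1 f f') :
    ∀ᵐ x ∂volume.restrict (I l), |f x| ≤ √l * ‖f'‖ := by
  filter_upwards [h.ae_eq_inner hl] with x hx
  exact hx ▸ abs_inner_leftIndicator_le hl.le x f'

theorem HasZeroTrace.norm_le (hl : 0 < l) {f f' : L2I l} (h : HasZeroTrace (I l) 1 f f') :
    ‖f‖ ≤ l * ‖f'‖ := by
  refine (Lp.norm_le_of_ae_bound (by positivity) (h.ae_abs_le hl)).trans_eq ?_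
  rw [ENNReal.toReal_ofNat, ← one_div, ← Real.sqrt_eq_rpow, ← mul_assoc]
  change √((volume.restrict (I l)).real univ) * √l * ‖f'‖ = l * ‖f'‖
  rw [measureReal_univ_restrict_I hl.le, Real.mul_self_sqrt hl.le]

theorem HasWeakDeriv.exists_ae_abs_le {f f' : L2I l} (h : HasWeakDeriv (I l) 1 f f') :
    ∃ B, ∀ᵐ x ∂volume.restrict (I l), |f x| ≤ B := by
  rcases le_or_gt l 0 with hl | hl
  · have hbot : ae (volume.restrict (I l)) = ⊥ := by
      rw [ae_eq_bot, I, Ioo_eq_empty (by linarith), Measure.restrict_empty]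
    exact ⟨0, hbot ▸ eventually_bot⟩
  obtain ⟨k, hk⟩ := HasWeakDeriv.exists_ae_eq_primitive_add_const (neg_lt_self (half_pos hl))
    (integrableOn_L2I f) (integrableOn_L2I f') h
  refine ⟨√l * ‖f'‖ + |k|, ?_⟩
  filter_upwards [hk, ae_restrict_mem measurableSet_Ioo] with x hx hxI
  rw [hx, ← inner_leftIndicator f' hxI]
  exact (abs_add_le _ _).trans (add_le_add_left (abs_inner_leftIndicator_le hl.le x f') _)

theorem measurePreserving_fst_S :
    MeasurePreserving Prod.fst (volume.restrict (S l)) (volume.restrict (I l)) := by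
  have : IsProbabilityMeasure (volume.restrict (Ioo (-(1 / 2) : ℝ) (1 / 2))) :=
    ⟨by simp only [Measure.restrict_apply_univ, Real.volume_Ioo]; norm_num⟩
  rw [S, Measure.volume_eq_prod, ← Measure.prod_restrict]
  exact measurePreserving_fst

theorem ae_S_of_ae_I {p : ℝ → Prop} (h : ∀ᵐ x ∂volume.restrict (I l), p x) :
    ∀ᵐ x ∂volume.restrict (S l), p x.1 :=
  measurePreserving_fst_S.quasiMeasurePreserving.ae h

theorem memLp_comp_fst (f : L2I l) : MemLp (fun x : ℝ × ℝ => f x.1) 2 (volume.restrict (S l)) :=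
  (Lp.memLp f).comp_measurePreserving measurePreserving_fst_S

theorem memLp_mul_comp_fst {f : L2I l} {B : ℝ} (hB : ∀ᵐ x ∂volume.restrict (I l), |f x| ≤ B)
    (g : L2I l) : MemLp (fun x : ℝ × ℝ => f x.1 * g x.1) 2 (volume.restrict (S l)) := by
  refine (memLp_comp_fst g).of_le_mul (c := B)
    ((memLp_comp_fst f).aestronglyMeasurable.mul (memLp_comp_fst g).aestronglyMeasurable) ?_
  filter_upwards [ae_S_of_ae_I hB] with x hx
  rw [norm_mul]
  exact mul_le_mul_of_nonneg_right hx (norm_nonneg _)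

theorem memLp_slope_mul_slope (w v : SobolevI l 2) :
    MemLp (fun x : ℝ × ℝ => w.1 1 x.1 * v.1 1 x.1) 2 (volume.restrict (S l)) :=
  memLp_mul_comp_fst (w.2 1).exists_ae_abs_le.choose_spec (v.1 1)

theorem ae_S_coeFn_add (f g : L2I l) :
    ∀ᵐ x ∂volume.restrict (S l), (f + g : L2I l) x.1 = f x.1 + g x.1 :=
  ae_S_of_ae_I (Lp.coeFn_add f g)

theorem ae_S_coeFn_smul (c : ℝ) (f : L2I l) :
    ∀ᵐ x ∂volume.restrict (S l), (c • f : L2I l) x.1 = c * f x.1 :=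
  ae_S_of_ae_I (Lp.coeFn_smul c f)

/-- The bilinear map `(w, v) ↦ w' v'`, with values in the functions on `S`. -/
def slopeMul (l : ℝ) : SobolevI l 2 →ₗ[ℝ] SobolevI l 2 →ₗ[ℝ] L2S l :=
  LinearMap.mk₂ ℝ (fun w v => (memLp_slope_mul_slope w v).toLp _)
    (fun w₁ w₂ v => by
      rw [← MemLp.toLp_add, MemLp.toLp_eq_toLp_iff]
      filter_upwards [ae_S_coeFn_add (w₁.1 1) (w₂.1 1)] with x hx
      exact (congrArg (· * v.1 1 x.1) hx).trans (add_mul _ _ _))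
    (fun c w v => by
      rw [← MemLp.toLp_const_smul, MemLp.toLp_eq_toLp_iff]
      filter_upwards [ae_S_coeFn_smul c (w.1 1)] with x hx
      exact (congrArg (· * v.1 1 x.1) hx).trans (mul_assoc _ _ _))
    (fun w v₁ v₂ => by
      rw [← MemLp.toLp_add, MemLp.toLp_eq_toLp_iff]
      filter_upwards [ae_S_coeFn_add (v₁.1 1) (v₂.1 1)] with x hx
      exact (congrArg (w.1 1 x.1 * ·) hx).trans (mul_add _ _ _))
    (fun c w v => by
      rw [← MemLp.toLp_const_smul, MemLp.toLp_eq_toLp_iff]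
      filter_upwards [ae_S_coeFn_smul c (v.1 1)] with x hx
      exact (congrArg (w.1 1 x.1 * ·) hx).trans (mul_left_comm _ _ _))

theorem coeFn_slopeMul (w v : SobolevI l 2) :
    slopeMul l w v =ᵐ[volume.restrict (S l)] fun x => w.1 1 x.1 * v.1 1 x.1 :=
  MemLp.coeFn_toLp (memLp_slope_mul_slope w v)

theorem slopeMul_comm (w v : SobolevI l 2) : slopeMul l w v = slopeMul l v w :=
  MemLp.toLp_congr (memLp_slope_mul_slope w v) (memLp_slope_mul_slope v w)
    (Eventually.of_forall fun _ => mul_comm _ _)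

theorem norm_slopeMul_le {w : SobolevI l 2} {B : ℝ}
    (hB : ∀ᵐ x ∂volume.restrict (I l), |w.1 1 x| ≤ B) (v : SobolevI l 2) :
    ‖slopeMul l w v‖ ≤ B * ‖v.1 1‖ := by
  rw [← Lp.norm_compMeasurePreserving (v.1 1) measurePreserving_fst_S]
  refine Lp.norm_le_mul_norm_of_ae_le_mul ?_
  filter_upwards [ae_S_of_ae_I hB, coeFn_slopeMul w v,
    Lp.coeFn_compMeasurePreserving (v.1 1) measurePreserving_fst_S] with x hw hmul hv
  rw [hmul, hv, norm_mul]
  exact mul_le_mul_of_nonneg_right hw (norm_nonneg _)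

end L2

/-! ### Partial minimization of quadratic forms -/

section PartialMinimization

variable {V : Type*} [AddCommGroup V] [Module ℝ V] (Q : QuadraticForm ℝ V) (e : V)

/-- The coefficient of the linear term in `α ↦ Q(v + α e) = Q(e) (α + κ(v))² + …`.  If `Q(e) = 0`
this is `0`, which for `Q ≥ 0` is the correct value. -/
def completionCoeff : V →ₗ[ℝ] ℝ := (2 * Q e)⁻¹ • Q.polarBilin e

/-- The form `v ↦ min_α Q(v + α e)`, for `Q ≥ 0`. -/
def minAlong : QuadraticForm ℝ V :=
  Q.comp (LinearMap.id - (completionCoeff Q e).smulRight e)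

theorem minAlong_apply (v : V) : minAlong Q e v = Q (v - completionCoeff Q e v • e) := rfl

variable {Q}

theorem minAlong_nonneg (hQ : ∀ v, 0 ≤ Q v) (v : V) : 0 ≤ minAlong Q e v := hQ _

theorem map_add_smul (v : V) (α : ℝ) :
    Q (v + α • e) = Q v + α * QuadraticMap.polar Q e v + α ^ 2 * Q e := by
  rw [QuadraticMap.map_add Q, QuadraticMap.map_smul, QuadraticMap.polar_smul_right,
    QuadraticMap.polar_comm]
  simp only [smul_eq_mul]
  ring

variable {e}

theorem polar_eq_zero_of_map_eq_zero (hQ : ∀ v, 0 ≤ Q v) (he : Q e = 0) (v : V) :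
    QuadraticMap.polar Q e v = 0 := by
  by_contra hne
  have h := hQ (v + (-(Q v + 1) / QuadraticMap.polar Q e v) • e)
  rw [map_add_smul, he, div_mul_cancel₀ _ hne] at h
  linarith

theorem map_mul_completionCoeff (hQ : ∀ v, 0 ≤ Q v) (v : V) :
    2 * Q e * completionCoeff Q e v = QuadraticMap.polar Q e v := by
  change 2 * Q e * ((2 * Q e)⁻¹ * QuadraticMap.polar Q e v) = _
  by_cases he : Q e = 0
  · rw [he, polar_eq_zero_of_map_eq_zero hQ he, mul_zero, zero_mul]
  · exact mul_inv_cancel_left₀ (mul_ne_zero two_ne_zero he) _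

theorem map_add_smul_eq_sq_add_minAlong (hQ : ∀ v, 0 ≤ Q v) (v : V) (α : ℝ) :
    Q (v + α • e) = Q e * (α + completionCoeff Q e v) ^ 2 + minAlong Q e v := by
  rw [minAlong_apply, sub_eq_add_neg, ← neg_smul, map_add_smul, map_add_smul,
    ← map_mul_completionCoeff hQ]
  ring

theorem iInf_map_add_smul (hQ : ∀ v, 0 ≤ Q v) (v : V) :
    ⨅ α : ℝ, Q (v + α • e) = minAlong Q e v := by
  simp only [map_add_smul_eq_sq_add_minAlong hQ]
  have hle : ∀ α : ℝ, minAlong Q e v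
      ≤ Q e * (α + completionCoeff Q e v) ^ 2 + minAlong Q e v := fun α =>
    le_add_of_nonneg_left (mul_nonneg (hQ e) (sq_nonneg _))
  refine le_antisymm ?_ (le_ciInf hle)
  refine (ciInf_le ⟨_, forall_mem_range.2 hle⟩ (-completionCoeff Q e v)).trans_eq ?_
  simp

end PartialMinimization

/-- The reduced forms of `Q` are `Q¹(p, q) = g (q + k p)² + c p²` and `Q⁰(p) = c p²`, with
nonnegative coefficients. -/
structure HasReducedForms (Q : QuadraticForm ℝ (Matrix (Fin 2) (Fin 2) ℝ)) (c g k : ℝ) : Prop where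
  nonneg_c : 0 ≤ c
  nonneg_g : 0 ≤ g
  Q1_eq : ∀ p q, Q1 Q p q = g * (q + k * p) ^ 2 + c * p ^ 2
  Q0_eq : ∀ p, Q0 Q p = c * p ^ 2

section ReducedForms

variable {Q : QuadraticForm ℝ (Matrix (Fin 2) (Fin 2) ℝ)}

theorem Q1_eq_minAlong (hQ : ∀ A, 0 ≤ Q A) (p q : ℝ) :
    Q1 Q p q = minAlong Q !![0, 0; 0, 1] (p • !![1, 0; 0, 0] + q • !![0, 1; 1, 0]) := by
  rw [← iInf_map_add_smul hQ]
  simp [Q1]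

theorem exists_hasReducedForms_of_nonneg (hQ : ∀ A, 0 ≤ Q A) :
    ∃ k, HasReducedForms Q
      (minAlong (minAlong Q !![0, 0; 0, 1]) !![0, 1; 1, 0] !![1, 0; 0, 0])
      (minAlong Q !![0, 0; 0, 1] !![0, 1; 1, 0]) k := by
  have hQ' := minAlong_nonneg !![0, 0; 0, 1] hQ
  refine ⟨completionCoeff (minAlong Q !![0, 0; 0, 1]) !![0, 1; 1, 0] !![1, 0; 0, 0],
    minAlong_nonneg _ hQ' _, hQ' _, fun p q => ?_, fun p => ?_⟩
  · rw [Q1_eq_minAlong hQ, map_add_smul_eq_sq_add_minAlong hQ', map_smul, QuadraticMap.map_smul]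
    simp only [smul_eq_mul]
    ring
  · simp only [Q0, Q1_eq_minAlong hQ, iInf_map_add_smul hQ', QuadraticMap.map_smul, smul_eq_mul]
    ring

theorem IsAdmissibleForm.nonneg (hQ : IsAdmissibleForm Q) (A : Matrix (Fin 2) (Fin 2) ℝ) :
    0 ≤ Q A := by
  rw [hQ.symmPart]
  by_cases h : (1 / 2 : ℝ) • (A + A.transpose) = 0
  · rw [h, QuadraticMap.map_zero]
  · exact (hQ.pos _ ((Matrix.isSymm_add_transpose_self A).smul _) h).le

theorem IsAdmissibleForm.exists_hasReducedForms (hQ : IsAdmissibleForm Q) :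
    ∃ c g k, 0 < c ∧ 0 < g ∧ HasReducedForms Q c g k := by
  obtain ⟨k, hk⟩ := exists_hasReducedForms_of_nonneg hQ.nonneg
  refine ⟨_, _, k, ?_, ?_, hk⟩
  · simp only [minAlong_apply]
    refine hQ.pos _ (by ext i j; fin_cases i <;> fin_cases j <;> simp) fun h => ?_
    simpa using congrFun (congrFun h 0) 0
  · simp only [minAlong_apply]
    refine hQ.pos _ (by ext i j; fin_cases i <;> fin_cases j <;> simp) fun h => ?_
    simpa using congrFun (congrFun h 0) 1

end ReducedForms

/-! ### The strain of a state -/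

/-- The space of strains: a membrane strain on `S`, a bending and a torsion strain on `I`. -/
abbrev Strain (l : ℝ) := WithLp 2 (L2S l × WithLp 2 (L2I l × L2I l))

section Strain

variable {l : ℝ}

/-- The lower triangular map `(a, b, d) ↦ (α a, β b, γ d + κ b)` on the space of strains. -/
def triangular (l α β γ κ : ℝ) : Strain l →L[ℝ] Strain l :=
  (WithLp.prodContinuousLinearEquiv 2 ℝ _ _).symm.toContinuousLinearMap ∘L
    ((α • WithLp.fstL 2 ℝ _ _).prod
      ((WithLp.prodContinuousLinearEquiv 2 ℝ _ _).symm.toContinuousLinearMap ∘L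
        ((β • WithLp.fstL 2 ℝ _ _ ∘L WithLp.sndL 2 ℝ _ _).prod
          (γ • WithLp.sndL 2 ℝ _ _ ∘L WithLp.sndL 2 ℝ _ _
            + κ • WithLp.fstL 2 ℝ _ _ ∘L WithLp.sndL 2 ℝ _ _))))

theorem triangular_apply (α β γ κ : ℝ) (h : Strain l) :
    triangular l α β γ κ h = WithLp.toLp 2 (α • h.fst,
      WithLp.toLp 2 (β • h.snd.fst, γ • h.snd.snd + κ • h.snd.fst)) := rfl

theorem triangular_triangular (α β γ κ α' β' γ' κ' : ℝ) (h : Strain l) :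
    triangular l α' β' γ' κ' (triangular l α β γ κ h)
      = triangular l (α' * α) (β' * β) (γ' * γ) (γ' * κ + κ' * β) h := by
  change WithLp.toLp 2 (α' • α • h.fst, WithLp.toLp 2 (β' • β • h.snd.fst,
    γ' • (γ • h.snd.snd + κ • h.snd.fst) + κ' • β • h.snd.fst)) = _
  simp only [triangular_apply, smul_add, smul_smul, add_smul, add_assoc]

theorem triangular_one (h : Strain l) : triangular l 1 1 1 0 h = h := by
  simp only [triangular_apply, one_smul, zero_smul, add_zero]
  rfl

/-- The map `h ↦ A h` for which `‖A h‖²` is the integral of the reduced forms with coefficients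
`c`, `g`, `k`. -/
def formMap (l c g k : ℝ) : Strain l →L[ℝ] Strain l :=
  triangular l (√c) (√(c / 12)) (√(g / 12)) (√(g / 12) * k)

theorem exists_norm_le_formMap {c g : ℝ} (l k : ℝ) (hc : 0 < c) (hg : 0 < g) :
    ∃ L, 0 ≤ L ∧ ∀ h : Strain l, ‖h‖ ≤ L * ‖formMap l c g k h‖ := by
  have hc₁ : √c ≠ 0 := by positivity
  have hc₂ : √(c / 12) ≠ 0 := by positivity
  have hg₁ : √(g / 12) ≠ 0 := by positivity
  let inv := triangular l (√c)⁻¹ (√(c / 12))⁻¹ (√(g / 12))⁻¹ (-(k * (√(c / 12))⁻¹))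
  have hinv : ∀ h, inv (formMap l c g k h) = h := fun h => by
    rw [formMap, triangular_triangular, inv_mul_cancel₀ hc₁, inv_mul_cancel₀ hc₂,
      inv_mul_cancel₀ hg₁, inv_mul_cancel_left₀ hg₁, neg_mul, inv_mul_cancel_right₀ hc₂,
      add_neg_cancel, triangular_one]
  exact ⟨‖inv‖, norm_nonneg _, fun h =>
    (congrArg norm (hinv h)).symm.trans_le (inv.le_opNorm _)⟩

theorem norm_sq_eq_integral {α : Type*} [MeasurableSpace α] {μ : Measure α} (f : Lp ℝ 2 μ) :
    ‖f‖ ^ 2 = ∫ x, (f x) ^ 2 ∂μ := by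
  rw [← real_inner_self_eq_norm_sq, L2.inner_def]
  refine integral_congr_ae (Eventually.of_forall fun x => ?_)
  simp only [real_inner_self_eq_norm_sq, Real.norm_eq_abs, sq_abs]

theorem norm_sqrt_smul_sq {E : Type*} [SeminormedAddCommGroup E] [NormedSpace ℝ E] {r : ℝ}
    (hr : 0 ≤ r) (x : E) : ‖√r • x‖ ^ 2 = r * ‖x‖ ^ 2 := by
  rw [norm_smul, mul_pow, Real.norm_eq_abs, sq_abs, Real.sq_sqrt hr]

variable {Q : QuadraticForm ℝ (Matrix (Fin 2) (Fin 2) ℝ)} {c g k : ℝ}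

theorem HasReducedForms.integral_Q0 (hQ : HasReducedForms Q c g k) (f : L2S l) :
    ∫ x in S l, Q0 Q (f x) = c * ‖f‖ ^ 2 := by
  simp only [hQ.Q0_eq, integral_const_mul, norm_sq_eq_integral]

theorem HasReducedForms.integral_Q1 (hQ : HasReducedForms Q c g k) (p q : L2I l) :
    ∫ t in I l, Q1 Q (p t) (q t) = g * ‖q + k • p‖ ^ 2 + c * ‖p‖ ^ 2 := by
  rw [norm_sq_eq_integral, norm_sq_eq_integral, ← integral_const_mul, ← integral_const_mul,
    ← integral_add ((Lp.memLp (q + k • p)).integrable_sq.const_mul g)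
      ((Lp.memLp p).integrable_sq.const_mul c)]
  refine integral_congr_ae ?_
  filter_upwards [Lp.coeFn_add q (k • p), Lp.coeFn_smul k p] with t hadd hsmul
  rw [hQ.Q1_eq, hadd, Pi.add_apply, hsmul, Pi.smul_apply, smul_eq_mul]

theorem HasReducedForms.norm_formMap_sq (hQ : HasReducedForms Q c g k) (h : Strain l) :
    ‖formMap l c g k h‖ ^ 2 = (∫ x in S l, Q0 Q (h.fst x))
      + 1 / 12 * ∫ t in I l, Q1 Q (h.snd.fst t) (h.snd.snd t) := by
  have hc := hQ.nonneg_c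
  have hg := hQ.nonneg_g
  rw [hQ.integral_Q0, hQ.integral_Q1, formMap, triangular_apply, WithLp.prod_norm_sq_eq_of_L2,
    WithLp.prod_norm_sq_eq_of_L2]
  simp only [mul_smul, ← smul_add]
  change ‖√c • h.fst‖ ^ 2 + (‖√(c / 12) • h.snd.fst‖ ^ 2
    + ‖√(g / 12) • (h.snd.snd + k • h.snd.fst)‖ ^ 2) = _
  rw [norm_sqrt_smul_sq hc, norm_sqrt_smul_sq (by positivity), norm_sqrt_smul_sq (by positivity)]
  ring

/-- The part `(∂₁y₁, w'', θ')` of the strain that is linear in the state. -/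
def linearStrain (l : ℝ) : Ambient l →L[ℝ] Strain l :=
  (WithLp.prodContinuousLinearEquiv 2 ℝ _ _).symm.toContinuousLinearMap ∘L
    (((PiLp.proj 2 (fun _ : Fin 2 × Fin 3 => L2S l) (0, 1)) ∘L (SobolevS l).subtypeL ∘L
        WithLp.fstL 1 ℝ _ _).prod
      ((WithLp.prodContinuousLinearEquiv 2 ℝ _ _).symm.toContinuousLinearMap ∘L
        (((PiLp.proj 2 (fun _ : Fin 3 => L2I l) 2) ∘L (SobolevI l 2).subtypeL ∘L
            WithLp.fstL 1 ℝ _ _ ∘L WithLp.sndL 1 ℝ _ _).prod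
          ((PiLp.proj 2 (fun _ : Fin 2 => L2I l) 1) ∘L (SobolevI l 1).subtypeL ∘L
            WithLp.sndL 1 ℝ _ _ ∘L WithLp.sndL 1 ℝ _ _))))

/-- The bilinear map `(w, v) ↦ (w' v', 0, 0)`. -/
def stretch (l : ℝ) : SobolevI l 2 →ₗ[ℝ] SobolevI l 2 →ₗ[ℝ] Strain l :=
  (slopeMul l).compr₂ ((WithLp.linearEquiv 2 ℝ _).symm.toLinearMap ∘ₗ LinearMap.inl ℝ _ _)

theorem stretch_comm (w v : SobolevI l 2) : stretch l w v = stretch l v w :=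
  congrArg (fun f => WithLp.toLp 2 (f, 0)) (slopeMul_comm w v)

theorem norm_stretch_le {w : SobolevI l 2} {B : ℝ}
    (hB : ∀ᵐ x ∂volume.restrict (I l), |w.1 1 x| ≤ B) (v : SobolevI l 2) :
    ‖stretch l w v‖ ≤ B * ‖v.1 1‖ :=
  (WithLp.norm_toLp_fst 2 _ _ (slopeMul l w v)).trans_le (norm_slopeMul_le hB v)

/-- The strain `(∂₁y₁ + |w'|²/2, w'', θ')`. -/
def strain (u : Ambient l) : Strain l := linearStrain l u + (1 / 2 : ℝ) • stretch l u.w u.w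

theorem strain_fst_ae (u : Ambient l) : (strain u).fst =ᵐ[volume.restrict (S l)]
    fun x => u.y.1 (0, 1) x + (u.w.1 1 x.1) ^ 2 / 2 := by
  change (u.y.1 (0, 1) + (1 / 2 : ℝ) • slopeMul l u.w u.w : L2S l) =ᵐ[_] _
  filter_upwards [Lp.coeFn_add (u.y.1 (0, 1)) ((1 / 2 : ℝ) • slopeMul l u.w u.w),
    Lp.coeFn_smul (1 / 2 : ℝ) (slopeMul l u.w u.w), coeFn_slopeMul u.w u.w]
    with x hadd hsmul hmul
  rw [hadd, Pi.add_apply, hsmul, Pi.smul_apply, hmul, smul_eq_mul]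
  ring

theorem strain_snd_fst (u : Ambient l) : (strain u).snd.fst = u.w.1 2 := by
  change u.w.1 2 + (1 / 2 : ℝ) • (0 : L2I l) = _
  rw [smul_zero, add_zero]

theorem strain_snd_snd (u : Ambient l) : (strain u).snd.snd = u.θ.1 1 := by
  change u.θ.1 1 + (1 / 2 : ℝ) • (0 : L2I l) = _
  rw [smul_zero, add_zero]

theorem strain_sub_snd_fst (u v : Ambient l) :
    (strain u - strain v).snd.fst = u.w.1 2 - v.w.1 2 :=
  congrArg₂ (· - ·) (strain_snd_fst u) (strain_snd_fst v)

theorem strain_sub_snd_snd (u v : Ambient l) :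
    (strain u - strain v).snd.snd = u.θ.1 1 - v.θ.1 1 :=
  congrArg₂ (· - ·) (strain_snd_snd u) (strain_snd_snd v)

theorem HasReducedForms.energy_eq (hQ : HasReducedForms Q c g k) (u : Ambient l) :
    energy Q u = 1 / 2 * ‖formMap l c g k (strain u)‖ ^ 2 := by
  have hmembrane : ∫ x in S l, Q0 Q ((strain u).fst x)
      = ∫ x in S l, Q0 Q (u.y.1 (0, 1) x + (u.w.1 1 x.1) ^ 2 / 2) :=
    integral_congr_ae ((strain_fst_ae u).fun_comp (Q0 Q))
  rw [hQ.norm_formMap_sq, strain_snd_fst, strain_snd_snd, hmembrane, energy]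
  ring

theorem HasReducedForms.dissip_eq (hQ : HasReducedForms Q c g k) (u v : Ambient l) :
    dissip Q u v = ‖formMap l c g k (strain u) - formMap l c g k (strain v)‖ := by
  rw [← map_sub, ← Real.sqrt_sq (norm_nonneg _), hQ.norm_formMap_sq, dissip, strain_sub_snd_fst,
    strain_sub_snd_snd]
  congr 2
  · refine integral_congr_ae ?_
    filter_upwards [strain_fst_ae u, strain_fst_ae v,
      Lp.coeFn_sub (strain u).fst (strain v).fst] with x hu hv hsub
    refine congrArg (Q0 Q) (Eq.symm ?_)
    refine hsub.trans ?_
    rw [Pi.sub_apply, hu, hv]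
    ring
  · congr 1
    refine integral_congr_ae ?_
    filter_upwards [Lp.coeFn_sub (u.w.1 2) (v.w.1 2), Lp.coeFn_sub (u.θ.1 1) (v.θ.1 1)]
      with t hw hθ
    rw [hw, hθ, Pi.sub_apply, Pi.sub_apply]

theorem exists_energy_eq (l : ℝ) (hQ : ∀ A, 0 ≤ Q A) :
    ∃ A : Strain l →L[ℝ] Strain l, ∀ u, energy Q u = 1 / 2 * ‖A (strain u)‖ ^ 2 := by
  obtain ⟨k, hk⟩ := exists_hasReducedForms_of_nonneg hQ
  exact ⟨_, hk.energy_eq⟩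

theorem IsAdmissibleForm.exists_dissip_eq (l : ℝ) (hQ : IsAdmissibleForm Q) :
    ∃ (B : Strain l →L[ℝ] Strain l) (L : ℝ), 0 ≤ L ∧ (∀ h, ‖h‖ ≤ L * ‖B h‖) ∧
      ∀ u v, dissip Q u v = ‖B (strain u) - B (strain v)‖ := by
  obtain ⟨c, g, k, hc, hg, hk⟩ := hQ.exists_hasReducedForms
  obtain ⟨L, hL, hB⟩ := exists_norm_le_formMap l k hc hg
  exact ⟨_, L, hL, hB, hk.dissip_eq⟩

theorem norm_bending_sub_le (u v : Ambient l) : ‖(u - v).w.1 2‖ ≤ ‖strain u - strain v‖ :=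
  (congrArg norm (strain_sub_snd_fst u v)).symm.trans_le
    ((WithLp.norm_fst_le _ _).trans (WithLp.norm_snd_le _ _))

theorem strain_add (u d : Ambient l) :
    strain (u + d) = strain u + linearStrain l d + stretch l u.w d.w
      + (1 / 2 : ℝ) • stretch l d.w d.w := by
  change linearStrain l (u + d) + (1 / 2 : ℝ) • stretch l (u.w + d.w) (u.w + d.w) = _
  simp only [strain, map_add, LinearMap.add_apply, stretch_comm d.w u.w]
  module

theorem strain_add_smul_sub (u v : Ambient l) (s : ℝ) :
    strain (u + s • (v - u)) = strain u + s • (strain v - strain u)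
      - (s * (1 - s)) • ((1 / 2 : ℝ) • stretch l (v - u).w (v - u).w) := by
  have hs := strain_add u (s • (v - u))
  have hv := strain_add u (v - u)
  have hw : (s • (v - u)).w = s • (v - u).w := rfl
  simp only [hw, map_smul, LinearMap.smul_apply] at hs
  rw [add_sub_cancel] at hv
  rw [hs, hv]
  module

theorem strain_add_sub (z u v : Ambient l) :
    strain (z + (v - u)) = strain z + (strain v - strain u)
      + stretch l (v - u).w (z - u).w := by
  have hz := strain_add z (v - u)
  have hv := strain_add u (v - u)
  have hw : stretch l (v - u).w (z - u).w
      = stretch l z.w (v - u).w - stretch l u.w (v - u).w := by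
    rw [stretch_comm z.w, stretch_comm u.w, ← map_sub]
    rfl
  rw [add_sub_cancel] at hv
  rw [hz, hv, hw]
  module

end Strain

/-! ### The affine structure of the admissible states -/

theorem coeFn_add_smul_sub {α : Type*} [MeasurableSpace α] {μ : Measure α} (f g h : Lp ℝ 2 μ)
    (c : ℝ) : (f + c • (g - h) : Lp ℝ 2 μ) =ᵐ[μ] fun x => f x + c * (g x - h x) := by
  filter_upwards [Lp.coeFn_add f (c • (g - h)), Lp.coeFn_smul c (g - h), Lp.coeFn_sub g h]
    with x hadd hsmul hsub
  rw [hadd, Pi.add_apply, hsmul, Pi.smul_apply, hsub, Pi.sub_apply, smul_eq_mul]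

section ZeroTrace

variable {V : Type*} [NormedAddCommGroup V] [NormedSpace ℝ V] [MeasureSpace V] {Ω : Set V} {e : V}

theorem HasZeroTrace.congr_ae {f f' g g' : V → ℝ} (h : HasZeroTrace Ω e f f')
    (hf : g =ᵐ[volume.restrict Ω] f) (hf' : g' =ᵐ[volume.restrict Ω] f') :
    HasZeroTrace Ω e g g' := by
  intro φ hφ hc
  rw [← h φ hφ hc]
  refine integral_congr_ae ?_
  filter_upwards [hf, hf'] with x hx hx'
  rw [hx, hx']

variable [BorelSpace V] [IsFiniteMeasureOnCompacts (volume : Measure V)]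

theorem HasZeroTrace.add_const_mul {f f' g g' : V → ℝ} (h : HasZeroTrace Ω e f f')
    (hf : MemLp f 2 (volume.restrict Ω)) (hf' : MemLp f' 2 (volume.restrict Ω))
    (h₁ : HasZeroTrace Ω e g g') (hg : MemLp g 2 (volume.restrict Ω))
    (hg' : MemLp g' 2 (volume.restrict Ω)) (c : ℝ) :
    HasZeroTrace Ω e (fun x => f x + c * g x) (fun x => f' x + c * g' x) := by
  intro φ hφ hc
  have hint : ∀ {f f' : V → ℝ}, MemLp f 2 (volume.restrict Ω) → MemLp f' 2 (volume.restrict Ω) →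
      Integrable (fun x => f x * fderiv ℝ φ x e + f' x * φ x) (volume.restrict Ω) :=
    fun hf hf' => (hf.integrable_mul (q := 2) (((continuous_dirDeriv hφ).memLp_of_hasCompactSupport
      (hasCompactSupport_dirDeriv hc)).restrict Ω)).add
      (hf'.integrable_mul (q := 2) ((hφ.continuous.memLp_of_hasCompactSupport hc).restrict Ω))
  calc _ = ∫ x in Ω, ((f x * fderiv ℝ φ x e + f' x * φ x)
        + c * (g x * fderiv ℝ φ x e + g' x * φ x)) := by
        congr with x
        ring
    _ = 0 := by
        rw [integral_add (hint hf hf') ((hint hg hg').const_mul c), integral_const_mul, h φ hφ hc,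
          h₁ φ hφ hc, mul_zero, add_zero]

variable {f f' g g' h h' : Lp ℝ 2 (volume.restrict Ω)} {b b' : V → ℝ}

theorem HasZeroTrace.sub (hb : MemLp b 2 (volume.restrict Ω))
    (hb' : MemLp b' 2 (volume.restrict Ω))
    (hf : HasZeroTrace Ω e (fun x => f x - b x) (fun x => f' x - b' x))
    (hg : HasZeroTrace Ω e (fun x => g x - b x) (fun x => g' x - b' x)) :
    HasZeroTrace Ω e (f - g : Lp ℝ 2 (volume.restrict Ω))
      (f' - g' : Lp ℝ 2 (volume.restrict Ω)) := by
  refine (hf.add_const_mul ((Lp.memLp f).sub hb) ((Lp.memLp f').sub hb') hg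
    ((Lp.memLp g).sub hb) ((Lp.memLp g').sub hb') (-1)).congr_ae ?_ ?_
  · filter_upwards [Lp.coeFn_sub f g] with x hx
    rw [hx, Pi.sub_apply]
    ring
  · filter_upwards [Lp.coeFn_sub f' g'] with x hx
    rw [hx, Pi.sub_apply]
    ring

theorem HasZeroTrace.add_smul_sub (hb : MemLp b 2 (volume.restrict Ω))
    (hb' : MemLp b' 2 (volume.restrict Ω))
    (hf : HasZeroTrace Ω e (fun x => f x - b x) (fun x => f' x - b' x))
    (hg : HasZeroTrace Ω e (fun x => g x - b x) (fun x => g' x - b' x))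
    (hh : HasZeroTrace Ω e (fun x => h x - b x) (fun x => h' x - b' x)) (c : ℝ) :
    HasZeroTrace Ω e (fun x => (f + c • (g - h) : Lp ℝ 2 (volume.restrict Ω)) x - b x)
      (fun x => (f' + c • (g' - h') : Lp ℝ 2 (volume.restrict Ω)) x - b' x) := by
  refine (hf.add_const_mul ((Lp.memLp f).sub hb) ((Lp.memLp f').sub hb')
    (hg.sub hb hb' hh) (Lp.memLp _) (Lp.memLp _) c).congr_ae ?_ ?_
  · filter_upwards [coeFn_add_smul_sub f g h c, Lp.coeFn_sub g h] with x hx hsub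
    rw [hx, hsub, Pi.sub_apply]
    ring
  · filter_upwards [coeFn_add_smul_sub f' g' h' c, Lp.coeFn_sub g' h'] with x hx hsub
    rw [hx, hsub, Pi.sub_apply]
    ring

end ZeroTrace

section S1D

variable {l : ℝ} {uhat₁ : SobolevI l 1} {uhat₂ vhat : SobolevI l 2}

theorem memLp_snd_mul_comp_fst (f : L2I l) :
    MemLp (fun x : ℝ × ℝ => x.2 * f x.1) 2 (volume.restrict (S l)) := by
  refine (memLp_comp_fst f).of_le_mul (c := 1 / 2)
    (measurable_snd.aestronglyMeasurable.mul (memLp_comp_fst f).aestronglyMeasurable) ?_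
  filter_upwards [ae_restrict_mem (measurableSet_Ioo.prod measurableSet_Ioo)] with x hx
  rw [norm_mul]
  exact mul_le_mul_of_nonneg_right (abs_le.2 ⟨hx.2.1.le, hx.2.2.le⟩) (norm_nonneg _)

theorem HasBoundaryValues.add_smul_sub {k : ℕ} {u v w b : SobolevI l k}
    (hu : HasBoundaryValues u b) (hv : HasBoundaryValues v b) (hw : HasBoundaryValues w b) (c : ℝ) :
    HasBoundaryValues (u + c • (v - w)) b := fun j =>
  (hu j).add_smul_sub (Lp.memLp _) (Lp.memLp _) (hv j) (hw j) c

theorem IsBernoulliNavier.add_smul_sub {u v w : SobolevS l}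
    (hu : IsBernoulliNavier uhat₁ uhat₂ u) (hv : IsBernoulliNavier uhat₁ uhat₂ v)
    (hw : IsBernoulliNavier uhat₁ uhat₂ w) (c : ℝ) :
    IsBernoulliNavier uhat₁ uhat₂ (u + c • (v - w)) := by
  obtain ⟨hu₁₂, hu₂₂, hu₁, hu₂⟩ := hu
  obtain ⟨hv₁₂, hv₂₂, hv₁, hv₂⟩ := hv
  obtain ⟨hw₁₂, hw₂₂, hw₁, hw₂⟩ := hw
  refine ⟨?_, ?_, ?_, ?_⟩
  · filter_upwards [hu₁₂, hv₁₂, hw₁₂,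
      coeFn_add_smul_sub (u.1 (0, 2)) (v.1 (0, 2)) (w.1 (0, 2)) c,
      coeFn_add_smul_sub (u.1 (1, 1)) (v.1 (1, 1)) (w.1 (1, 1)) c] with x hu hv hw h₀₂ h₁₁
    change ((u.1 (0, 2) + c • (v.1 (0, 2) - w.1 (0, 2)) : L2S l) x
      + (u.1 (1, 1) + c • (v.1 (1, 1) - w.1 (1, 1)) : L2S l) x) / 2 = 0
    rw [h₀₂, h₁₁]
    linear_combination hu + c * (hv - hw)
  · filter_upwards [hu₂₂, hv₂₂, hw₂₂,
      coeFn_add_smul_sub (u.1 (1, 2)) (v.1 (1, 2)) (w.1 (1, 2)) c] with x hu hv hw h₁₂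
    change (u.1 (1, 2) + c • (v.1 (1, 2) - w.1 (1, 2)) : L2S l) x = 0
    rw [h₁₂]
    linear_combination hu + c * (hv - hw)
  · exact hu₁.add_smul_sub ((memLp_comp_fst _).sub (memLp_snd_mul_comp_fst _))
      ((memLp_comp_fst _).sub (memLp_snd_mul_comp_fst _)) hv₁ hw₁ c
  · exact hu₂.add_smul_sub (memLp_comp_fst _) (memLp_comp_fst _) hv₂ hw₂ c

theorem add_smul_sub_mem_S1D {u v w : Ambient l} (hu : u ∈ S1D uhat₁ uhat₂ vhat)
    (hv : v ∈ S1D uhat₁ uhat₂ vhat) (hw : w ∈ S1D uhat₁ uhat₂ vhat) (c : ℝ) :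
    u + c • (v - w) ∈ S1D uhat₁ uhat₂ vhat :=
  ⟨hu.1.add_smul_sub hv.1 hw.1 c, hu.2.1.add_smul_sub hv.2.1 hw.2.1 c,
    hu.2.2.add_smul_sub hv.2.2 hw.2.2 c⟩

theorem hasZeroTrace_slope_sub (u v : S1D uhat₁ uhat₂ vhat) :
    HasZeroTrace (I l) 1 ((u - v : Ambient l).w.1 1) ((u - v : Ambient l).w.1 2) :=
  (u.2.2.1 1).sub (Lp.memLp _) (Lp.memLp _) (v.2.2.1 1)

theorem norm_stretch_sub_le (hl : 0 < l) (u v : S1D uhat₁ uhat₂ vhat) :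
    ‖stretch l (u - v : Ambient l).w (u - v : Ambient l).w‖
      ≤ √l * l * ‖strain u.1 - strain v.1‖ ^ 2 := by
  have htrace := hasZeroTrace_slope_sub u v
  have hbend := norm_bending_sub_le u.1 v.1
  calc _ ≤ √l * ‖(u - v : Ambient l).w.1 2‖ * ‖(u - v : Ambient l).w.1 1‖ :=
        norm_stretch_le (htrace.ae_abs_le hl) _
    _ ≤ √l * ‖strain u.1 - strain v.1‖ * (l * ‖strain u.1 - strain v.1‖) := by
        gcongr
        exact (htrace.norm_le hl).trans (by gcongr)
    _ = _ := by ring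

theorem isAlmostAffine_strain (hl : 0 < l) (uhat₁ : SobolevI l 1) (uhat₂ vhat : SobolevI l 2) :
    IsAlmostAffine (fun u : S1D uhat₁ uhat₂ vhat => strain u.1)
      (fun u : S1D uhat₁ uhat₂ vhat => strain u.1) (1 + √l * l) where
  nonneg := by positivity
  norm_sub_le u v := le_mul_of_one_le_left (norm_nonneg _) (le_add_of_nonneg_right (by positivity))
  exists_path u v := by
    have hdefect : ‖(1 / 2 : ℝ) • stretch l (v - u : Ambient l).w (v - u : Ambient l).w‖
        ≤ (1 + √l * l) * ‖strain u.1 - strain v.1‖ ^ 2 := by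
      have hstretch := norm_stretch_sub_le hl v u
      rw [norm_sub_rev (strain v.1)] at hstretch
      rw [norm_smul, Real.norm_of_nonneg (by norm_num)]
      linarith [norm_nonneg (stretch l (v - u : Ambient l).w (v - u : Ambient l).w),
        sq_nonneg ‖strain u.1 - strain v.1‖]
    exact ⟨_, _, hdefect, hdefect, fun s _ => ⟨⟨_, add_smul_sub_mem_S1D u.2 v.2 u.2 s⟩,
      strain_add_smul_sub u.1 v.1 s, strain_add_smul_sub u.1 v.1 s⟩⟩

end S1D

theorem IsAlmostAffine.continuousLinearMap_comp {X E H : Type*} [NormedAddCommGroup E]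
    [NormedSpace ℝ E] [NormedAddCommGroup H] [NormedSpace ℝ H] {a b : X → E} {K L : ℝ}
    (h : IsAlmostAffine a b K) (A B : E →L[ℝ] H) (hL : 0 ≤ L) (hB : ∀ x, ‖x‖ ≤ L * ‖B x‖) :
    IsAlmostAffine (fun u => A (a u)) (fun u => B (b u)) ((‖A‖ + ‖B‖) * (K * (L + L ^ 2))) := by
  have hK := h.nonneg
  have hb : ∀ u v, ‖b u - b v‖ ≤ L * ‖B (b u) - B (b v)‖ := fun u v =>
    (hB _).trans_eq (by rw [map_sub])
  refine ⟨by positivity, fun u v => ?_, fun u v => ?_⟩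
  · rw [← map_sub A]
    calc _ ≤ ‖A‖ * ‖a u - a v‖ := A.le_opNorm _
      _ ≤ ‖A‖ * (K * (L * ‖B (b u) - B (b v)‖)) := by
        gcongr
        exact (h.norm_sub_le u v).trans (by gcongr; exact hb u v)
      _ = ‖A‖ * (K * L) * ‖B (b u) - B (b v)‖ := by ring
      _ ≤ _ := by gcongr <;> nlinarith [norm_nonneg B]
  · obtain ⟨p, q, hp, hq, hpath⟩ := h.exists_path u v
    have hcomp : ∀ (T : E →L[ℝ] H) {x : E}, ‖T‖ ≤ ‖A‖ + ‖B‖ → ‖x‖ ≤ K * ‖b u - b v‖ ^ 2 →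
        ‖T x‖ ≤ (‖A‖ + ‖B‖) * (K * (L + L ^ 2)) * ‖B (b u) - B (b v)‖ ^ 2 := fun T x hT hx =>
      calc _ ≤ ‖T‖ * ‖x‖ := T.le_opNorm _
        _ ≤ (‖A‖ + ‖B‖) * (K * (L * ‖B (b u) - B (b v)‖) ^ 2) := by
          gcongr
          exact hx.trans (by gcongr; exact hb u v)
        _ = (‖A‖ + ‖B‖) * (K * L ^ 2) * ‖B (b u) - B (b v)‖ ^ 2 := by ring
        _ ≤ _ := by gcongr; linarith
    refine ⟨A p, B q, hcomp A (le_add_of_nonneg_right (norm_nonneg _)) hp,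
      hcomp B (le_add_of_nonneg_left (norm_nonneg _)) hq, fun s hs => ?_⟩
    obtain ⟨z, haz, hbz⟩ := hpath s hs
    exact ⟨z, by simp only [haz, map_sub, map_add, map_smul],
      by simp only [hbz, map_sub, map_add, map_smul]⟩

theorem exists_isAlmostAffine_comp_strain {l : ℝ} (hl : 0 < l)
    {QW QR : QuadraticForm ℝ (Matrix (Fin 2) (Fin 2) ℝ)} (hW : ∀ A, 0 ≤ QW A)
    (hR : IsAdmissibleForm QR) :
    ∃ (A B : Strain l →L[ℝ] Strain l) (L K : ℝ), (∀ h, ‖h‖ ≤ L * ‖B h‖) ∧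
      (∀ u, energy QW u = 1 / 2 * ‖A (strain u)‖ ^ 2) ∧
      (∀ u v, dissip QR u v = ‖B (strain u) - B (strain v)‖) ∧ 0 ≤ K ∧
      ∀ uhat₁ uhat₂ vhat, IsAlmostAffine (fun u : S1D uhat₁ uhat₂ vhat => A (strain u.1))
        (fun u => B (strain u.1)) K := by
  obtain ⟨A, henergy⟩ := exists_energy_eq l hW
  obtain ⟨B, L, hL, hB, hdissip⟩ := hR.exists_dissip_eq l
  have h := fun uhat₁ uhat₂ vhat =>
    (isAlmostAffine_strain hl uhat₁ uhat₂ vhat).continuousLinearMap_comp A B hL hB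
  exact ⟨A, B, L, _, hB, henergy, hdissip, (h 0 0 0).nonneg, h⟩

/-! ### Lower semicontinuity of the slope -/

section Hilbert

variable {H : Type*} [NormedAddCommGroup H] [InnerProductSpace ℝ H]

theorem tendsto_inner_of_weak_of_strong {ι : Type*} {F : Filter ι} {x d : ι → H} {x₀ d₀ : H}
    {N : ℝ} (hN : ∀ᶠ i in F, ‖x i‖ ≤ N)
    (hx : ∀ h, Tendsto (fun i => inner ℝ (x i) h) F (𝓝 (inner ℝ x₀ h)))
    (hd : Tendsto d F (𝓝 d₀)) :
    Tendsto (fun i => inner ℝ (x i) (d i)) F (𝓝 (inner ℝ x₀ d₀)) := by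
  have hsmall : Tendsto (fun i => inner ℝ (x i) (d i - d₀)) F (𝓝 0) := by
    have hbound : Tendsto (fun i => N * ‖d i - d₀‖) F (𝓝 (N * 0)) :=
      (tendsto_iff_norm_sub_tendsto_zero.1 hd).const_mul N
    rw [mul_zero] at hbound
    refine squeeze_zero_norm' ?_ hbound
    filter_upwards [hN] with i hi
    exact (norm_inner_le_norm _ _).trans (mul_le_mul_of_nonneg_right hi (norm_nonneg _))
  have hsum := hsmall.add (hx d₀)
  rw [zero_add] at hsum
  refine hsum.congr fun i => ?_
  rw [inner_sub_right, sub_add_cancel]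

theorem exists_norm_le_of_weak [CompleteSpace H] {x : ℕ → H} {x₀ : H}
    (hx : ∀ h, Tendsto (fun i => inner ℝ (x i) h) atTop (𝓝 (inner ℝ x₀ h))) :
    ∃ N, ∀ i, ‖x i‖ ≤ N := by
  obtain ⟨N, hN⟩ := banach_steinhaus (g := fun i => innerSL ℝ (x i)) fun h => by
    obtain ⟨C, hC⟩ := (hx h).norm.bddAbove_range
    exact ⟨C, fun i => hC (mem_range_self i)⟩
  exact ⟨N, fun i => (innerSL_apply_norm ℝ (x i)).symm.trans_le (hN i)⟩

/-- By `½‖x‖² - ½‖y‖² = ⟨x - y, x⟩ - ½‖x - y‖²`, energy differences pass to the limit under weak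
convergence of `a (z i)` if the differences to the recovery family converge strongly. -/
theorem IsAlmostAffine.quadraticSlope_le_liminf_of_weak {X : Type*} {a b : X → H} {K N : ℝ}
    (h : IsAlmostAffine a b K) {ι : Type*} {F : Filter ι} {z : ι → X} {u : X}
    (hN : ∀ᶠ i in F, ‖a (z i)‖ ≤ N)
    (hweak : ∀ x, Tendsto (fun i => inner ℝ (a (z i)) x) F (𝓝 (inner ℝ (a u) x)))
    (hrec : ∀ v, ∃ v' : ι → X, Tendsto (fun i => a (v' i) - a (z i)) F (𝓝 (a v - a u)) ∧
      Tendsto (fun i => b (v' i) - b (z i)) F (𝓝 (b v - b u))) :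
    quadraticSlope a b u ≤ liminf (fun i => quadraticSlope a b (z i)) F := by
  refine h.quadraticSlope_le_liminf (M := 1 / 2 * N ^ 2) ?_ fun v => ?_
  · filter_upwards [hN] with i hi
    gcongr
  obtain ⟨v', ha, hb⟩ := hrec v
  have hexpand : ∀ x y : H, 1 / 2 * ‖x‖ ^ 2 - 1 / 2 * ‖y‖ ^ 2
      = -inner ℝ x (y - x) - 1 / 2 * ‖y - x‖ ^ 2 := fun x y => by
    rw [half_norm_sq_sub, ← neg_sub y x, inner_neg_left, norm_neg, real_inner_comm]
  refine ⟨v', ?_, ?_⟩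
  · simp only [hexpand]
    exact (tendsto_inner_of_weak_of_strong hN hweak ha).neg.sub ((ha.norm.pow 2).const_mul _)
  · simp only [norm_sub_rev (b u), norm_sub_rev (b (z _))]
    exact hb.norm

end Hilbert

section S1D

variable {l : ℝ} {uhat₁ : SobolevI l 1} {uhat₂ vhat : SobolevI l 2}

theorem tendsto_stretch_zero {ι : Type*} {F : Filter ι} {w v : ι → SobolevI l 2} {B : ℝ}
    (hB : ∀ i, ∀ᵐ x ∂volume.restrict (I l), |(w i).1 1 x| ≤ B)
    (hv : Tendsto (fun i => ‖(v i).1 1‖) F (𝓝 0)) :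
    Tendsto (fun i => stretch l (w i) (v i)) F (𝓝 0) := by
  have hbound := hv.const_mul B
  rw [mul_zero] at hbound
  exact squeeze_zero_norm (fun i => norm_stretch_le (hB i) (v i)) hbound

/-- The recovery family for `v` is `z i + (v - u)`. -/
theorem quadraticSlope_strain_le_liminf {H : Type*} [NormedAddCommGroup H] [InnerProductSpace ℝ H]
    [CompleteSpace H] {A B : Strain l →L[ℝ] H} {K N : ℝ}
    (h : IsAlmostAffine (fun u : S1D uhat₁ uhat₂ vhat => A (strain u.1))
      (fun u => B (strain u.1)) K) {ι : Type*} {F : Filter ι}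
    {z : ι → S1D uhat₁ uhat₂ vhat} {u : S1D uhat₁ uhat₂ vhat}
    (hN : ∀ᶠ i in F, ‖strain (z i).1‖ ≤ N)
    (hweak : ∀ x, Tendsto (fun i => inner ℝ (strain (z i).1) x) F (𝓝 (inner ℝ (strain u.1) x)))
    (hslope : Tendsto (fun i => ‖(z i - u : Ambient l).w.1 1‖) F (𝓝 0)) :
    quadraticSlope (fun u : S1D uhat₁ uhat₂ vhat => A (strain u.1)) (fun u => B (strain u.1)) u
      ≤ liminf (fun i => quadraticSlope (fun u : S1D uhat₁ uhat₂ vhat => A (strain u.1))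
        (fun u => B (strain u.1)) (z i)) F := by
  refine h.quadraticSlope_le_liminf_of_weak (N := ‖A‖ * N) ?_ (fun x => ?_) fun v => ?_
  · filter_upwards [hN] with i hi
    exact (A.le_opNorm _).trans (by gcongr)
  · simp only [← ContinuousLinearMap.adjoint_inner_right]
    exact hweak _
  have hrec : Tendsto (fun i => strain (z i + (v - u) : Ambient l) - strain (z i).1) F
      (𝓝 (strain v.1 - strain u.1)) := by
    obtain ⟨C, hC⟩ := ((v - u : Ambient l).w.2 1).exists_ae_abs_le
    have hlim := (tendsto_stretch_zero (fun _ => hC) hslope).const_add (strain v.1 - strain u.1)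
    rw [add_zero] at hlim
    refine hlim.congr fun i => ?_
    rw [strain_add_sub]
    abel
  have hmem : ∀ i, (z i + (v - u) : Ambient l) ∈ S1D uhat₁ uhat₂ vhat := fun i => by
    simpa only [one_smul] using add_smul_sub_mem_S1D (z i).2 v.2 u.2 1
  refine ⟨fun i => ⟨_, hmem i⟩, ?_, ?_⟩
  · simpa only [Function.comp_def, map_sub] using (A.continuous.tendsto _).comp hrec
  · simpa only [Function.comp_def, map_sub] using (B.continuous.tendsto _).comp hrec

theorem quadraticSlope_strain_le_liminf_comap (hl : 0 < l) {H : Type*} [NormedAddCommGroup H]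
    [InnerProductSpace ℝ H] [CompleteSpace H] {A B : Strain l →L[ℝ] H} {K L : ℝ}
    (h : IsAlmostAffine (fun u : S1D uhat₁ uhat₂ vhat => A (strain u.1))
      (fun u => B (strain u.1)) K) (hB : ∀ x, ‖x‖ ≤ L * ‖B x‖) (u : S1D uhat₁ uhat₂ vhat) :
    quadraticSlope (fun u : S1D uhat₁ uhat₂ vhat => A (strain u.1)) (fun u => B (strain u.1)) u
      ≤ liminf (quadraticSlope (fun u : S1D uhat₁ uhat₂ vhat => A (strain u.1))
          (fun u => B (strain u.1)))
        (comap (fun v => ‖B (strain u.1) - B (strain v.1)‖) (𝓝 0)) := by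
  set F := comap (fun v : S1D uhat₁ uhat₂ vhat => ‖B (strain u.1) - B (strain v.1)‖) (𝓝 0)
  have hnorm : Tendsto (fun v : S1D uhat₁ uhat₂ vhat => ‖strain v.1 - strain u.1‖) F (𝓝 0) := by
    have hbound := (tendsto_comap (f := fun v : S1D uhat₁ uhat₂ vhat =>
      ‖B (strain u.1) - B (strain v.1)‖) (x := 𝓝 0)).const_mul L
    rw [mul_zero] at hbound
    refine squeeze_zero (fun _ => norm_nonneg _) (fun v => ?_) hbound
    rw [norm_sub_rev, ← map_sub]
    exact hB _
  have hlim : Tendsto (fun v : S1D uhat₁ uhat₂ vhat => strain v.1) F (𝓝 (strain u.1)) :=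
    tendsto_iff_norm_sub_tendsto_zero.2 hnorm
  refine quadraticSlope_strain_le_liminf h
    (hlim.norm.eventually_le_const (lt_add_one ‖strain u.1‖))
    (fun x => hlim.inner tendsto_const_nhds) ?_
  have hbound := hnorm.const_mul l
  rw [mul_zero] at hbound
  refine squeeze_zero (fun _ => norm_nonneg _) (fun v => ?_) hbound
  exact ((hasZeroTrace_slope_sub v u).norm_le hl).trans
    (mul_le_mul_of_nonneg_left (norm_bending_sub_le _ _) hl.le)

/-- Zero traces turn weak convergence of the derivatives into pointwise convergence, since point
evaluation is the pairing of the derivative with `leftIndicator`. -/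
theorem tendsto_norm_zero_of_hasZeroTrace (hl : 0 < l) {f f' : ℕ → L2I l}
    (h : ∀ k, HasZeroTrace (I l) 1 (f k) (f' k))
    (hweak : ∀ g, Tendsto (fun k => inner ℝ (f' k) g) atTop (𝓝 0)) {N : ℝ} (hN : ∀ k, ‖f' k‖ ≤ N) :
    Tendsto (fun k => ‖f k‖) atTop (𝓝 0) := by
  have hbound : ∀ k, ∀ᵐ x ∂volume.restrict (I l), ‖f k x ^ 2‖ ≤ (√l * N) ^ 2 := fun k => by
    filter_upwards [(h k).ae_abs_le hl] with x hx
    rw [norm_pow, Real.norm_eq_abs]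
    gcongr
    exact hx.trans (by gcongr; exact hN k)
  have hpointwise : ∀ᵐ x ∂volume.restrict (I l), Tendsto (fun k => f k x ^ 2) atTop (𝓝 0) := by
    filter_upwards [ae_all_iff.2 fun k => (h k).ae_eq_inner hl] with x hx
    have hlim := (hweak (leftIndicator l x)).pow 2
    rw [zero_pow two_ne_zero] at hlim
    exact hlim.congr fun k => by rw [hx, real_inner_comm]
  have hsq : Tendsto (fun k => ‖f k‖ ^ 2) atTop (𝓝 0) := by
    have hlim := tendsto_integral_of_dominated_convergence (fun _ => (√l * N) ^ 2)
      (fun k => (Lp.aestronglyMeasurable (f k)).pow 2) (integrable_const _) hbound hpointwise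
    rw [integral_zero] at hlim
    exact hlim.congr fun k => (norm_sq_eq_integral (f k)).symm
  have hsqrt := hsq.sqrt
  rw [Real.sqrt_zero] at hsqrt
  exact hsqrt.congr fun k => Real.sqrt_sq (norm_nonneg _)

section Weak

variable {z : ℕ → S1D uhat₁ uhat₂ vhat} {u : S1D uhat₁ uhat₂ vhat}

theorem tendsto_inner_bending_sub
    (hz : ∀ f : Ambient l →L[ℝ] ℝ, Tendsto (fun k => f (z k - u)) atTop (𝓝 0)) (g : L2I l) :
    Tendsto (fun k => inner ℝ ((z k - u : Ambient l).w.1 2) g) atTop (𝓝 0) :=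
  (hz (innerSL ℝ g ∘L WithLp.fstL 2 ℝ _ _ ∘L WithLp.sndL 2 ℝ _ _ ∘L linearStrain l)).congr
    fun _ => real_inner_comm _ _

theorem exists_norm_bending_sub_le
    (hz : ∀ f : Ambient l →L[ℝ] ℝ, Tendsto (fun k => f (z k - u)) atTop (𝓝 0)) :
    ∃ N, ∀ k, ‖(z k - u : Ambient l).w.1 2‖ ≤ N :=
  exists_norm_le_of_weak (x₀ := (0 : L2I l)) fun g => by
    simpa only [inner_zero_left] using tendsto_inner_bending_sub hz g

theorem tendsto_norm_slope_sub (hl : 0 < l)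
    (hz : ∀ f : Ambient l →L[ℝ] ℝ, Tendsto (fun k => f (z k - u)) atTop (𝓝 0)) :
    Tendsto (fun k => ‖(z k - u : Ambient l).w.1 1‖) atTop (𝓝 0) := by
  obtain ⟨N, hN⟩ := exists_norm_bending_sub_le hz
  exact tendsto_norm_zero_of_hasZeroTrace hl (fun k => hasZeroTrace_slope_sub (z k) u)
    (tendsto_inner_bending_sub hz) hN

theorem tendsto_strain_sub_linearStrain (hl : 0 < l)
    (hz : ∀ f : Ambient l →L[ℝ] ℝ, Tendsto (fun k => f (z k - u)) atTop (𝓝 0)) :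
    Tendsto (fun k => strain (z k).1 - linearStrain l (z k - u)) atTop (𝓝 (strain u.1)) := by
  obtain ⟨N, hN⟩ := exists_norm_bending_sub_le hz
  obtain ⟨B, hB⟩ := (u.1.w.2 1).exists_ae_abs_le
  have hslope := tendsto_norm_slope_sub hl hz
  have hcross := tendsto_stretch_zero (fun _ => hB) hslope
  have hsquare := tendsto_stretch_zero (w := fun k => (z k - u : Ambient l).w) (B := √l * N)
    (fun k => by
      filter_upwards [(hasZeroTrace_slope_sub (z k) u).ae_abs_le hl] with x hx
      exact hx.trans (by gcongr; exact hN k)) hslope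
  have hlim := (hcross.add (hsquare.const_smul (1 / 2 : ℝ))).const_add (strain u.1)
  rw [smul_zero, add_zero, add_zero] at hlim
  refine hlim.congr fun k => ?_
  have hstrain := strain_add u.1 (z k - u)
  rw [add_sub_cancel] at hstrain
  rw [hstrain]
  abel

theorem tendsto_inner_strain (hl : 0 < l)
    (hz : ∀ f : Ambient l →L[ℝ] ℝ, Tendsto (fun k => f (z k - u)) atTop (𝓝 0)) (h : Strain l) :
    Tendsto (fun k => inner ℝ (strain (z k).1) h) atTop (𝓝 (inner ℝ (strain u.1) h)) := by
  have hlin : Tendsto (fun k => inner ℝ (linearStrain l (z k - u)) h) atTop (𝓝 0) :=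
    (hz (innerSL ℝ h ∘L linearStrain l)).congr fun _ => real_inner_comm _ _
  have hlim := ((tendsto_strain_sub_linearStrain hl hz).inner (𝕜 := ℝ)
    (tendsto_const_nhds (x := h))).add hlin
  rw [add_zero] at hlim
  refine hlim.congr fun k => ?_
  rw [← inner_add_left, sub_add_cancel]

theorem quadraticSlope_strain_le_liminf_of_weak (hl : 0 < l) {H : Type*} [NormedAddCommGroup H]
    [InnerProductSpace ℝ H] [CompleteSpace H] {A B : Strain l →L[ℝ] H} {K : ℝ}
    (h : IsAlmostAffine (fun u : S1D uhat₁ uhat₂ vhat => A (strain u.1))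
      (fun u => B (strain u.1)) K)
    (hz : Tendsto (fun k => toWeakSpace ℝ (Ambient l) (z k).1) atTop
      (𝓝 (toWeakSpace ℝ (Ambient l) u.1))) :
    quadraticSlope (fun u : S1D uhat₁ uhat₂ vhat => A (strain u.1)) (fun u => B (strain u.1)) u
      ≤ liminf (fun k => quadraticSlope (fun u : S1D uhat₁ uhat₂ vhat => A (strain u.1))
        (fun u => B (strain u.1)) (z k)) atTop := by
  have hsub : ∀ f : Ambient l →L[ℝ] ℝ, Tendsto (fun k => f (z k - u)) atTop (𝓝 0) := fun f => by
    have hf : Tendsto (fun k => f (z k).1) atTop (𝓝 (f u.1)) :=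
      ((WeakBilin.eval_continuous (topDualPairing ℝ (Ambient l)).flip f).tendsto _).comp hz
    simpa only [map_sub, sub_self] using hf.sub_const (f u.1)
  obtain ⟨N, hN⟩ := exists_norm_le_of_weak (tendsto_inner_strain hl hsub)
  exact quadraticSlope_strain_le_liminf h (Eventually.of_forall hN) (tendsto_inner_strain hl hsub)
    (tendsto_norm_slope_sub hl hsub)

end Weak

end S1D

end VKRibbon

end

theorem lemma4p3_general (l : ℝ) (hl : 0 < l)
    (QW QR : QuadraticForm ℝ (Matrix (Fin 2) (Fin 2) ℝ))
    (hW : ∀ A, 0 ≤ QW A) (hR : IsAdmissibleForm QR) :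
    ∃ C₀ : ℝ, 0 < C₀ ∧ ∀ (uhat₁ : SobolevI l 1) (uhat₂ vhat : SobolevI l 2),
      (∀ C : ℝ, C₀ ≤ C → ∀ M : ℝ, 0 < M → ∀ u : S1D uhat₁ uhat₂ vhat, energy QW u.1 ≤ M →
        slope1D QW QR uhat₁ uhat₂ vhat u =
          ⨆ (v : S1D uhat₁ uhat₂ vhat) (_ : u ≠ v),
            ENNReal.ofReal
              (max (energy QW u.1 - energy QW v.1 - Φ₂ C M (dissip QR u.1 v.1)) 0
                / Φ₁ C (dissip QR u.1 v.1))) ∧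
      IsStrongUpperGradient (fun u v : S1D uhat₁ uhat₂ vhat => dissip QR u.1 v.1)
        (fun u => energy QW u.1) (slope1D QW QR uhat₁ uhat₂ vhat) ∧
      (∀ (z : ℕ → S1D uhat₁ uhat₂ vhat) (u : S1D uhat₁ uhat₂ vhat),
        Filter.Tendsto (fun k => toWeakSpace ℝ (Ambient l) (z k).1) Filter.atTop
          (nhds (toWeakSpace ℝ (Ambient l) u.1)) →
        slope1D QW QR uhat₁ uhat₂ vhat u ≤
          Filter.liminf (fun k => slope1D QW QR uhat₁ uhat₂ vhat (z k)) Filter.atTop) := by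
  obtain ⟨A, B, L, K, hB, henergy, hdissip, hK, halmost⟩ :=
    exists_isAlmostAffine_comp_strain hl hW hR
  refine ⟨(K + 1) ^ 2, by positivity, fun uhat₁ uhat₂ vhat => ?_⟩
  have h := halmost uhat₁ uhat₂ vhat
  simp only [slope1D, henergy, hdissip]
  exact ⟨fun C hC M _ u hM => h.quadraticSlope_eq hC hM,
    h.isStrongUpperGradient_quadraticSlope (quadraticSlope_strain_le_liminf_comap hl h hB),
    fun z u hz => quadraticSlope_strain_le_liminf_of_weak hl h hz⟩

theorem lemma4p3 (l : ℝ) (hl : 0 < l)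
    (QW QR : QuadraticForm ℝ (Matrix (Fin 2) (Fin 2) ℝ))
    (hW : IsAdmissibleForm QW) (hR : IsAdmissibleForm QR) :
    ∃ C₀ : ℝ, 0 < C₀ ∧ ∀ (uhat₁ : SobolevI l 1) (uhat₂ vhat : SobolevI l 2),
      -- representation of the local slope on sublevel sets
      (∀ C : ℝ, C₀ ≤ C → ∀ M : ℝ, 0 < M → ∀ u : S1D uhat₁ uhat₂ vhat, energy QW u.1 ≤ M →
        slope1D QW QR uhat₁ uhat₂ vhat u =
          ⨆ (v : S1D uhat₁ uhat₂ vhat) (_ : u ≠ v),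
            ENNReal.ofReal
              (max (energy QW u.1 - energy QW v.1 - Φ₂ C M (dissip QR u.1 v.1)) 0
                / Φ₁ C (dissip QR u.1 v.1))) ∧
      -- the local slope is a strong upper gradient
      IsStrongUpperGradient (fun u v : S1D uhat₁ uhat₂ vhat => dissip QR u.1 v.1)
        (fun u => energy QW u.1) (slope1D QW QR uhat₁ uhat₂ vhat) ∧
      -- the local slope is weakly sequentially lower semicontinuous
      (∀ (z : ℕ → S1D uhat₁ uhat₂ vhat) (u : S1D uhat₁ uhat₂ vhat),
        Filter.Tendsto (fun k => toWeakSpace ℝ (Ambient l) (z k).1) Filter.atTop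
          (nhds (toWeakSpace ℝ (Ambient l) u.1)) →
        slope1D QW QR uhat₁ uhat₂ vhat u ≤
          Filter.liminf (fun k => slope1D QW QR uhat₁ uhat₂ vhat (z k)) Filter.atTop) :=
  lemma4p3_general l hl QW QR hW.nonneg hR
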